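/- **Setting.** Let $\mathcal L_0$ be the language of $ID_1$: arithmetic ($0$, $S$, $=$ and further function and relation symbols with a standard interpretation on $\mathbb N$) plus a predicate $I$. For each quantifier-free *simple* formula $\phi(x,\vec y)$ (one containing no closed terms) add a Skolem function $c_{\exists x\phi}(\vec y)$; iterating gives $\mathcal L_0\subseteq\mathcal L_1\subseteq\cdots$, and $\mathcal L_\epsilon$ is the quantifier-free part of the union. The simple rank $rk_s$ of an expression is the least $n$ such that it lies in $\mathcal L_n$. Write $\exists x\,\phi(x,\vec t)$ for $\phi(c_{\exists x\phi}(\vec t),\vec t)$ and $\forall x\,\phi(x,\vec t)$ for $\phi(c_{\exists x\neg\phi}(\vec t),\vec t)$. Fix $A(x,X)=\forall z\,B(z,x,X)$, with $B$ simple, quantifier-free, without Skolem functions and with $X$ occurring only positively. The critical formulas are $\neg s=0\to\exists x\,s=Sx$ (Pred), $\phi(t)\to\exists x\,\phi(x)$ (Epsilon), $\phi(0)\wedge\neg\phi(t)\to\exists x(\phi(x)\wedge\neg\phi(Sx))$ (Induction), $A(t,I)\to t\in I$ (Inductive Definition) and $\forall x(A(x,\phi)\to\phi(x))\to\forall x(x\in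 I\to\phi(x))$ (Closure). Let $\mathrm{Cr}=\{Cr_0,\dots,Cr_N\}$ be a finite list of closed critical formulas. *Ranks and substitutions.* Canonical expressions are terms $c(\vec n)$ with $c$ a Skolem function and $\vec n$ numerals, and formulas $n\in I$; put $c_n=c_{\exists z\neg B(z,x,I)}(n)$. Ranks: $rk(n\in I)=rk(c_n)=\Omega$; for every other canonical term $e=c_{\exists x\phi}(\vec n)$, $rk(e)=rk_s(e)$ if $I$ does not occur in $\phi$ (not even inside Skolem function symbols), and $rk(e)=\Omega+rk_s(e)+1$ if it does. An $\epsilon$-substitution $S$ is a partial function giving canonical terms values that are $?$ or a positive numeral, and formulas $n\in I$ the value $?$ or $\top$. $|\cdot|_S$ denotes evaluation by $S$ ($?$ being read as $0$, respectively $\bot$), $S\vDash\phi$ means that $|\phi|_S$ is a true arithmetical sentence, $S$ decides $\phi$ if $S\vDash\phi$ or $S\vDash\neg\phi$, and $\overline S$ extends $S$ by $?$ elsewhere. $F(e,?)=\top$, $F(c_{\exists x\phi}(\vec n),u)=\phi(u,\vec n)\wedge\bigwedge_{v<u}\neg\phi(v,\vec n)$, $F(n\in I,\top)=A(n,I)$.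 $S$ is correct if $\overline S\vDash F(e,u)$ for all $(e,u)\in S$, and solving if $\overline S\vDash Cr_i$ for all $i\le N$. $S$ is computationally inconsistent if $S\vDash\neg F(e,u)$ for some $(e,u)\in S$, or if $(c_n,u),(n\in I,\top)\in S$ for some $n$ and some $u\ne{?}$. *Sequents.* $S^-_{=\Omega}$ is the set of pairs $(c_m,u)$ with $u\neq{?}$ and $(m\in I,?)$ in $S$; $S^+_{=\Omega}$ is the set of pairs $(c_m,?)$ and $(m\in I,\top)$ in $S$. A history $(P,V)$ is a finite sequence $P$ of distinct formulas $n\in I$ and a function $V$ on its entries whose values are finite $\epsilon$-substitutions $T$ with $T^-_{=\Omega}=T$. A sequent $\Theta=(S,P,V,F)$ consists of an $\epsilon$-substitution $S$, a history $(P,V)$ such that $P$ enumerates $\{n\in I\mid (n\in I,\top)\in S\}$, and labels $F(e)\in\{t,f\}$ for exactly those $e\in\operatorname{dom}(S)$ with $S(e)={?}$ or $rk(e)=\Omega$. $\emptyset$ is the empty sequent. $P=\langle n_1\in I,\dots,n_k\in I\rangle$ is admissible if, for each $i\le k$, $B(0,n_i,I)$ is true when $I$ is read as $\{n_j\mid j<i\}$.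 *The $H$-step.* Let $S$ be correct and nonsolving. To each $Cr_i$ with $\overline S\not\vDash Cr_i$ assign $(e_i,v_i)$, where $|\cdot|=|\cdot|_{\overline S}$ and $\vec s$ are the closed parameters of the matrix: for Pred, $(c_{\exists x\,y=Sx}(|s|),|s|-1)$; for Epsilon, $(c_{\exists x\phi}(|\vec s|),|t|)$; for Induction, $(c_{\exists x(\phi(x)\wedge\neg\phi(Sx))}(|\vec s|),m)$ with $m<|t|$ least such that $\overline S\vDash\phi(m)$ and $\overline S\vDash\neg\phi(m+1)$; for Inductive Definition, $(|t|\in I,\top)$; for Closure, with $n\in I$ the first entry of $P$ such that $\overline S\vDash\neg\phi(n)$, $(c_n,\overline S(c_{\exists z\neg B(z,x,\phi)}(n,|\vec s|)))$ if $\overline S\vDash\neg A(n,\phi)$, and $(c_{\exists x\neg(A(x,\phi)\to\phi(x))}(|\vec s|),n)$ otherwise. The $H$-expression $e$ and $H$-value $v$ are $(e_i,v_i)$ for the failing $i$ with $rk(e_i)$ least and then $i$ least. The substitution part of $H(S,P,V)$ is: $(S_{\le rk(e)}\setminus\{(e,?)\})\cup\{(e,v)\}$ if $rk(e)\ne\Omega$;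 $S_{<\Omega}\cup S^+_{=\Omega}\cup\{(e,\top)\}$ if $e$ is a formula; and, if $e=c_n$, $S_{<\Omega}\cup\{(c_m,?),(m\in I,\top)\in S\mid m\in I\text{ in }P'\}\cup V'\cup\{(c_n,v)\}$, where $P'$ is the longest initial segment of $P$ not containing $n\in I$ and $V'=V(n\in I)$ if $n\in I$ is in $P$, $V'=S^-_{=\Omega}$ otherwise. The $H$-step applies if all these calculations take place in $S$ rather than only in $\overline S$: $S$ decides every $Cr_i$; for every failing $Cr_i$, all terms $s,t,\vec s$ above evaluate to numerals in $S$, and $S$ decides $\phi(m)$ for all $m\le|t|$ (Induction), respectively decides $\phi(m)$ for all $m\in I$ in $P$ up to and including $n\in I$, decides $A(n,\phi)$, and in the first case contains the term whose value is $v_i$ in its domain (Closure); $(e,?)\in S$; if $e=c_n$ then $n\in I\in\operatorname{dom}(S)$; if $e$ is $n\in I$ then $c_n\in\operatorname{dom}(S)$; and if $e$ is a term of rank $\Omega$ then $m\in I\in\operatorname{dom}(S)$ whenever $(c_m,?)\in S$. An expression $e'\in\operatorname{dom}(S)$ is active if $rk(e')=rk(e)$ and $e'$ is missing from $H(S,P,V)$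 or has a different value there. *Axioms and $Cut$ rules.* $\Theta$ is an axiom if $S$ is computationally inconsistent ($AxF$), or $S$ is solving ($AxS$), or the $H$-step applies and some active $e'$ has $F(e')=f$ ($AxH$). The $Cut$ rules infer $\Theta$ from the following premises, where $e\notin\operatorname{dom}(S)$. - For a canonical term $e$ of rank $\neq\Omega$: $\Theta$ extended by $(e,?)$ with label $f$, and, for every $u\ge 1$, $\Theta$ extended by $(e,u)$. - For a canonical term $e$ of rank $\Omega$: the same premises, all with label $f$. - For $e$ a formula $n\in I$: $\Theta$ extended by $(e,?)$ with label $f$, and, for every history $(P_e,V_e)$ such that $P_e$ ends in $e$, has no entries in $\operatorname{dom}(S)$, has no entry $m\in I$ with $(c_m,u)\in S$ for some $u\neq{?}$, and is such that $P{}^\frown P_e$ is admissible, $\Theta$ extended by $(m\in I,\top)$ with label $f$ for all $m\in I$ in $P_e$, with $P$ extended to $P{}^\frown P_e$ and $V$ to $V\cup V_e$. In each case $e$ is the main expression of the inference, and its rank is $rk(e)$. A derivation is a well-founded tree of sequents all of whose leaves are axioms. Finally let $\rho(\emptyset,\mathrm{Cr})=\max_{i\le N} rk_s(|Cr_i|_\emptyset)$.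 **Theorem.** There is a derivation of the empty sequent $\emptyset$ all of whose inferences are $Cut$-inferences of rank $\le\Omega+\rho(\emptyset,\mathrm{Cr})+1$. -/

import Mathlib

open scoped Ordinal

noncomputable section

namespace EpsID1

/-! The quantifier-free Skolemized language of `ID₁`.

The arithmetical part consists of `0`, `S`, `=` and the further function and relation symbols of
an arbitrary first-order language `L` (for instance `+`, `·`, `<`), read in the standard model `ℕ`
by an `L`-structure on `ℕ`. -/

mutual
/-- Terms with free variables among `var 0, …, var (n - 1)`. `skol φ ts` is the term
`c_{∃ x φ(x, y₀, …, y_{k-1})}(ts)`, where `x` is variable `0` of `φ` and `yᵢ` is variable `i + 1`.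
The formula `φ` belongs to the name of the function symbol. -/
inductive Term (L : FirstOrder.Language.{0, 0}) : ℕ → Type
  | var {n : ℕ} (i : Fin n) : Term L n
  | zero {n : ℕ} : Term L n
  | succ {n : ℕ} (t : Term L n) : Term L n
  | func {n k : ℕ} (f : L.Functions k) (ts : Fin k → Term L n) : Term L n
  | skol {n k : ℕ} (φ : Formula L (k + 1)) (ts : Fin k → Term L n) : Term L n
/-- Quantifier-free formulas. `mem t` is the atomic formula `t ∈ I`. -/
inductive Formula (L : FirstOrder.Language.{0, 0}) : ℕ → Type
  | top {n : ℕ} : Formula L n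
  | bot {n : ℕ} : Formula L n
  | eq {n : ℕ} (s t : Term L n) : Formula L n
  | rel {n k : ℕ} (R : L.Relations k) (ts : Fin k → Term L n) : Formula L n
  | mem {n : ℕ} (t : Term L n) : Formula L n
  | neg {n : ℕ} (φ : Formula L n) : Formula L n
  | and {n : ℕ} (φ ψ : Formula L n) : Formula L n
  | or {n : ℕ} (φ ψ : Formula L n) : Formula L n
end

variable {L : FirstOrder.Language.{0, 0}}

def Formula.imp {n : ℕ} (φ ψ : Formula L n) : Formula L n := .or (.neg φ) ψ

/-- The numeral `S … S 0`. -/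
def numeral {n : ℕ} : ℕ → Term L n
  | 0 => .zero
  | m + 1 => .succ (numeral m)

/-- The number denoted by a term, if the term is a numeral. -/
def Term.num? {n : ℕ} : Term L n → Option ℕ
  | .zero => some 0
  | .succ t => t.num?.map Nat.succ
  | .var _ => none
  | .func _ _ => none
  | .skol _ _ => none

/-- The numbers denoted by a tuple of terms, if all of them are numerals. -/
def nums? {n k : ℕ} (ts : Fin k → Term L n) : Option (Fin k → ℕ) :=
  if ∀ i, (ts i).num?.isSome then some (fun i => (ts i).num?.getD 0) else none

/-- Simultaneous substitution. -/
def Term.subst {n m : ℕ} (σ : Fin n → Term L m) : Term L n → Term L m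
  | .var i => σ i
  | .zero => .zero
  | .succ t => .succ (t.subst σ)
  | .func f ts => .func f (fun i => (ts i).subst σ)
  | .skol φ ts => .skol φ (fun i => (ts i).subst σ)

def Formula.subst {n m : ℕ} (σ : Fin n → Term L m) : Formula L n → Formula L m
  | .top => .top
  | .bot => .bot
  | .eq s t => .eq (s.subst σ) (t.subst σ)
  | .rel R ts => .rel R (fun i => (ts i).subst σ)
  | .mem t => .mem (t.subst σ)
  | .neg φ => .neg (φ.subst σ)
  | .and φ ψ => .and (φ.subst σ) (ψ.subst σ)
  | .or φ ψ => .or (φ.subst σ) (ψ.subst σ)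

/-- Replacement of every atomic formula `t ∈ I` of `ψ` by `χ t`. -/
def Formula.plug {n : ℕ} (χ : Term L n → Formula L n) : Formula L n → Formula L n
  | .top => .top
  | .bot => .bot
  | .eq s t => .eq s t
  | .rel R ts => .rel R ts
  | .mem t => χ t
  | .neg φ => .neg (φ.plug χ)
  | .and φ ψ => .and (φ.plug χ) (ψ.plug χ)
  | .or φ ψ => .or (φ.plug χ) (ψ.plug χ)

/-- The term has no variables. -/
def Term.Closed {n : ℕ} : Term L n → Prop
  | .var _ => False
  | .zero => True
  | .succ t => t.Closed
  | .func _ ts => ∀ i, (ts i).Closed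
  | .skol _ ts => ∀ i, (ts i).Closed

/-- No subterm (the term itself included) is closed. -/
def Term.Simple {n : ℕ} : Term L n → Prop
  | .var _ => True
  | .zero => False
  | .succ t => t.Simple
  | .func f ts => ¬ (Term.func f ts).Closed ∧ ∀ i, (ts i).Simple
  | .skol φ ts => ¬ (Term.skol φ ts).Closed ∧ ∀ i, (ts i).Simple

/-- The formula is simple: it contains no closed terms. -/
def Formula.Simple {n : ℕ} : Formula L n → Prop
  | .top => True
  | .bot => True
  | .eq s t => s.Simple ∧ t.Simple
  | .rel _ ts => ∀ i, (ts i).Simple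
  | .mem t => t.Simple
  | .neg φ => φ.Simple
  | .and φ ψ => φ.Simple ∧ ψ.Simple
  | .or φ ψ => φ.Simple ∧ ψ.Simple

mutual
/-- The term belongs to `𝓛_ε`: Skolem functions are introduced for simple formulas only. -/
def Term.WF {n : ℕ} : Term L n → Prop
  | .var _ => True
  | .zero => True
  | .succ t => t.WF
  | .func _ ts => ∀ i, (ts i).WF
  | .skol φ ts => (φ.Simple ∧ φ.WF) ∧ ∀ i, (ts i).WF
/-- The formula belongs to `𝓛_ε`. -/
def Formula.WF {n : ℕ} : Formula L n → Prop
  | .top => True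
  | .bot => True
  | .eq s t => s.WF ∧ t.WF
  | .rel _ ts => ∀ i, (ts i).WF
  | .mem t => t.WF
  | .neg φ => φ.WF
  | .and φ ψ => φ.WF ∧ ψ.WF
  | .or φ ψ => φ.WF ∧ ψ.WF
end

mutual
/-- The simple rank: the least `n` with the term in `𝓛ₙ`, where `𝓛₀` has no Skolem functions and
`𝓛ₙ₊₁` adds a Skolem function for every simple formula of `𝓛ₙ`. -/
def Term.rkS {n : ℕ} : Term L n → ℕ
  | .var _ => 0
  | .zero => 0
  | .succ t => t.rkS
  | .func _ ts => Finset.univ.sup fun i => (ts i).rkS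
  | .skol φ ts => max (φ.rkS + 1) (Finset.univ.sup fun i => (ts i).rkS)
/-- The simple rank of a formula. -/
def Formula.rkS {n : ℕ} : Formula L n → ℕ
  | .top => 0
  | .bot => 0
  | .eq s t => max s.rkS t.rkS
  | .rel _ ts => Finset.univ.sup fun i => (ts i).rkS
  | .mem t => t.rkS
  | .neg φ => φ.rkS
  | .and φ ψ => max φ.rkS ψ.rkS
  | .or φ ψ => max φ.rkS ψ.rkS
end

mutual
/-- `I` occurs in the term, possibly in the name of a Skolem function. -/
def Term.HasI {n : ℕ} : Term L n → Prop
  | .var _ => False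
  | .zero => False
  | .succ t => t.HasI
  | .func _ ts => ∃ i, (ts i).HasI
  | .skol φ ts => φ.HasI ∨ ∃ i, (ts i).HasI
/-- `I` occurs in the formula, possibly in the name of a Skolem function. -/
def Formula.HasI {n : ℕ} : Formula L n → Prop
  | .top => False
  | .bot => False
  | .eq s t => s.HasI ∨ t.HasI
  | .rel _ ts => ∃ i, (ts i).HasI
  | .mem _ => True
  | .neg φ => φ.HasI
  | .and φ ψ => φ.HasI ∨ ψ.HasI
  | .or φ ψ => φ.HasI ∨ ψ.HasI
end

/-- The term has no Skolem functions. -/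
def Term.NoSkol {n : ℕ} : Term L n → Prop
  | .var _ => True
  | .zero => True
  | .succ t => t.NoSkol
  | .func _ ts => ∀ i, (ts i).NoSkol
  | .skol _ _ => False

/-- The formula has no Skolem functions, i.e. is a quantifier-free formula of `𝓛₀`. -/
def Formula.NoSkol {n : ℕ} : Formula L n → Prop
  | .top => True
  | .bot => True
  | .eq s t => s.NoSkol ∧ t.NoSkol
  | .rel _ ts => ∀ i, (ts i).NoSkol
  | .mem t => t.NoSkol
  | .neg φ => φ.NoSkol
  | .and φ ψ => φ.NoSkol ∧ ψ.NoSkol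
  | .or φ ψ => φ.NoSkol ∧ ψ.NoSkol

/-- The formula is in the language of arithmetic: no Skolem functions and no `I`. -/
def Formula.IsArith {n : ℕ} (φ : Formula L n) : Prop := φ.NoSkol ∧ ¬ φ.HasI

/-- With `b = true`: all occurrences of `I` are positive; with `b = false`: all are negative. -/
def Formula.Polar {n : ℕ} (b : Bool) : Formula L n → Prop
  | .top => True
  | .bot => True
  | .eq _ _ => True
  | .rel _ _ => True
  | .mem _ => b = true
  | .neg φ => φ.Polar (!b)
  | .and φ ψ => φ.Polar b ∧ ψ.Polar b
  | .or φ ψ => φ.Polar b ∧ ψ.Polar b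

/-- Standard value of an arithmetical term (Skolem terms get a dummy value). -/
def Term.val [L.Structure ℕ] {n : ℕ} (x : Fin n → ℕ) : Term L n → ℕ
  | .var i => x i
  | .zero => 0
  | .succ t => t.val x + 1
  | .func f ts => FirstOrder.Language.Structure.funMap f (fun i => (ts i).val x)
  | .skol _ _ => 0

/-- Truth of an arithmetical formula in the standard model; only used under `IsArith`. -/
def Formula.Realize [L.Structure ℕ] {n : ℕ} (x : Fin n → ℕ) : Formula L n → Prop
  | .top => True
  | .bot => False
  | .eq s t => s.val x = t.val x
  | .rel R ts => FirstOrder.Language.Structure.RelMap R (fun i => (ts i).val x)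
  | .mem _ => False
  | .neg φ => ¬ φ.Realize x
  | .and φ ψ => φ.Realize x ∧ ψ.Realize x
  | .or φ ψ => φ.Realize x ∨ ψ.Realize x

/-- Truth of an arithmetical sentence. -/
def Formula.Holds [L.Structure ℕ] (φ : Formula L 0) : Prop := φ.Realize Fin.elim0

/-! Quantifiers as abbreviations, for a matrix `φ(x, y⃗)` and a tuple `s⃗`. -/

/-- `∃ x φ(x, s⃗)`, i.e. `φ(c_{∃ x φ}(s⃗), s⃗)`. -/
def exF {n k : ℕ} (φ : Formula L (k + 1)) (s : Fin k → Term L n) : Formula L n :=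
  φ.subst (Fin.cons (.skol φ s) s)

/-- `∀ x φ(x, s⃗)`, i.e. `φ(c_{∃ x ¬φ}(s⃗), s⃗)`. -/
def allF {n k : ℕ} (φ : Formula L (k + 1)) (s : Fin k → Term L n) : Formula L n :=
  φ.subst (Fin.cons (.skol φ.neg s) s)

/-- The matrix `B(z, x, X)` of the inductive definition `A(x, X) = ∀ z B(z, x, X)`. The variable
`z` is `var 0`, `x` is `var 1`, and the atoms `mem t` stand for `t ∈ X`. -/
structure PosOp (L : FirstOrder.Language.{0, 0}) where
  B : Formula L 2
  noSkol : B.NoSkol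
  simple : B.Simple
  pos : B.Polar true

/-- `A(t, I)`. -/
def PosOp.A {n : ℕ} (D : PosOp L) (t : Term L n) : Formula L n := allF D.B (fun _ : Fin 1 => t)

/-- `B(z, x, φ)` for `φ = φ(·, y⃗)`, as a formula in `z, x, y⃗`. -/
def PosOp.Bφ {k : ℕ} (D : PosOp L) (φ : Formula L (k + 1)) : Formula L (k + 2) :=
  (D.B.subst (fun i : Fin 2 => Term.var (Fin.castLE (by omega) i))).plug
    (fun t => φ.subst (Fin.cons t (fun i => Term.var i.succ.succ)))

/-- `A(t, φ)` for `φ = φ(·, s⃗)`. -/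
def PosOp.Aφ {n k : ℕ} (D : PosOp L) (φ : Formula L (k + 1)) (s : Fin k → Term L n)
    (t : Term L n) : Formula L n :=
  allF (D.Bφ φ) (Fin.cons t s)

/-- `A(x, φ) → φ(x)`, as a formula in `x, y⃗`. -/
def PosOp.prog {k : ℕ} (D : PosOp L) (φ : Formula L (k + 1)) : Formula L (k + 1) :=
  (D.Aφ φ (fun i => .var i.succ) (.var 0)).imp φ

/-- `φ(x) ∧ ¬φ(S x)`, as a formula in `x, y⃗`. -/
def indStep {k : ℕ} (φ : Formula L (k + 1)) : Formula L (k + 1) :=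
  φ.and (φ.subst (Fin.cons (.succ (.var 0)) (fun i => .var i.succ))).neg

/-- `y = S x`, as a formula in `x, y`. -/
def predMatrix : Formula L 2 := .eq (.var 1) (.succ (.var 0))

/-- Closed critical formulas. The matrices `φ(x, y⃗)` are simple; `s⃗` is the tuple of closed terms
substituted for `y⃗`. -/
inductive Critical (L : FirstOrder.Language.{0, 0}) : Type
  | pred (s : Term L 0) : Critical L
  | eps {k : ℕ} (φ : Formula L (k + 1)) (s : Fin k → Term L 0) (t : Term L 0) : Critical L
  | ind {k : ℕ} (φ : Formula L (k + 1)) (s : Fin k → Term L 0) (t : Term L 0) : Critical L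
  | inddef (t : Term L 0) : Critical L
  | closure {k : ℕ} (φ : Formula L (k + 1)) (s : Fin k → Term L 0) : Critical L

/-- All ingredients belong to `𝓛_ε`, and the matrix is simple. -/
def Critical.WF : Critical L → Prop
  | .pred s => s.WF
  | .eps φ s t => (φ.Simple ∧ φ.WF) ∧ (∀ i, (s i).WF) ∧ t.WF
  | .ind φ s t => (φ.Simple ∧ φ.WF) ∧ (∀ i, (s i).WF) ∧ t.WF
  | .inddef t => t.WF
  | .closure φ s => (φ.Simple ∧ φ.WF) ∧ ∀ i, (s i).WF

/-- `φ(t, s⃗)`. -/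
def inst {n k : ℕ} (φ : Formula L (k + 1)) (s : Fin k → Term L n) (t : Term L n) : Formula L n :=
  φ.subst (Fin.cons t s)

/-- The critical formula itself. -/
def Critical.toFormula (D : PosOp L) : Critical L → Formula L 0
  | .pred s => (Formula.eq s .zero).neg.imp (exF predMatrix (fun _ : Fin 1 => s))
  | .eps φ s t => (inst φ s t).imp (exF φ s)
  | .ind φ s t => ((inst φ s .zero).and (inst φ s t).neg).imp (exF (indStep φ) s)
  | .inddef t => (D.A t).imp (.mem t)
  | .closure φ s => (allF (D.prog φ) s).imp (allF ((Formula.mem (.var 0)).imp φ) s)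

/-! Canonical expressions, ranks, substitutions. -/

/-- `term φ v` is `c_{∃ x φ}(v)` with numerals `v`; `form n` is the formula `n ∈ I`. -/
inductive CanExpr (L : FirstOrder.Language.{0, 0}) : Type
  | term {k : ℕ} (φ : Formula L (k + 1)) (v : Fin k → ℕ) : CanExpr L
  | form (n : ℕ) : CanExpr L

/-- The Skolem function is one of `𝓛_ε`. -/
def CanExpr.IsCanonical : CanExpr L → Prop
  | .term φ _ => φ.Simple ∧ φ.WF
  | .form _ => True

def CanExpr.IsTerm : CanExpr L → Prop
  | .term _ _ => True
  | .form _ => False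

/-- `c_n`, the term `c_{∃ z ¬B(z, x, I)}(n)`. -/
def PosOp.c (D : PosOp L) (n : ℕ) : CanExpr L := .term D.B.neg (fun _ : Fin 1 => n)

/-- The ordinal `Ω`; all other ranks are of the form `m` or `Ω + m` with `m` finite. -/
def Om : Ordinal.{0} := ω₁

open Classical in
/-- The rank of a canonical expression. -/
def PosOp.rk (D : PosOp L) : CanExpr L → Ordinal.{0}
  | .form _ => Om
  | .term φ v =>
      if ∃ n, CanExpr.term φ v = D.c n then Om
      else if φ.HasI then Om + ((φ.rkS + 1 : ℕ) : Ordinal.{0}) + 1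
      else ((φ.rkS + 1 : ℕ) : Ordinal.{0})

/-- The symbol `?`, numerals, and `⊤`. -/
inductive Val : Type
  | unk : Val
  | num (n : ℕ) : Val
  | tt : Val

/-- Terms get `?` or a positive numeral, formulas get `?` or `⊤`. -/
def CanExpr.Fits : CanExpr L → Val → Prop
  | .term _ _, .unk => True
  | .term _ _, .num n => 0 < n
  | .term _ _, .tt => False
  | .form _, .unk => True
  | .form _, .num _ => False
  | .form _, .tt => True

/-- Partial functions from canonical expressions to values. -/
abbrev Sub (L : FirstOrder.Language.{0, 0}) : Type := CanExpr L → Option Val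

/-- `S` is an `ε`-substitution. -/
def Sub.IsSub (S : Sub L) : Prop := ∀ e u, S e = some u → e.IsCanonical ∧ e.Fits u

def Sub.dom (S : Sub L) : Set (CanExpr L) := {e | (S e).isSome}

/-- The set of pairs `(e, u) ∈ S`. -/
def Sub.graph (S : Sub L) : Set (CanExpr L × Val) := {p | S p.1 = some p.2}

open Classical in
/-- The standard extension of `S`: every other canonical expression gets `?`. -/
def Sub.bar (S : Sub L) : Sub L := fun e =>
  match S e with
  | some u => some u
  | none => if e.IsCanonical then some .unk else none

/-- The reduction `|t|_S`. -/
def Term.red [L.Structure ℕ] {n : ℕ} (S : Sub L) : Term L n → Term L n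
  | .var i => .var i
  | .zero => .zero
  | .succ t => .succ (t.red S)
  | .func f ts =>
      match nums? (fun i => (ts i).red S) with
      | some v => numeral (FirstOrder.Language.Structure.funMap f v)
      | none => .func f (fun i => (ts i).red S)
  | .skol φ ts =>
      match nums? (fun i => (ts i).red S) with
      | some v =>
          match S (.term φ v) with
          | some (.num m) => numeral m
          | some _ => .zero
          | none => .skol φ (fun i => (ts i).red S)
      | none => .skol φ (fun i => (ts i).red S)

/-- The reduction `|φ|_S`. -/
def Formula.red [L.Structure ℕ] {n : ℕ} (S : Sub L) : Formula L n → Formula L n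
  | .top => .top
  | .bot => .bot
  | .eq s t => .eq (s.red S) (t.red S)
  | .rel R ts => .rel R (fun i => (ts i).red S)
  | .mem t =>
      match (t.red S).num? with
      | some m =>
          match S (.form m) with
          | some .tt => .top
          | some _ => .bot
          | none => .mem (t.red S)
      | none => .mem (t.red S)
  | .neg φ => .neg (φ.red S)
  | .and φ ψ => .and (φ.red S) (ψ.red S)
  | .or φ ψ => .or (φ.red S) (ψ.red S)

section Semantics

variable [L.Structure ℕ]

/-- `S ⊨ φ`. -/
def Sub.Sat (S : Sub L) (φ : Formula L 0) : Prop := (φ.red S).IsArith ∧ (φ.red S).Holds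

/-- `S` decides `φ`. -/
def Sub.Decides (S : Sub L) (φ : Formula L 0) : Prop := S.Sat φ ∨ S.Sat φ.neg

/-- `⋀_{v < u} ¬φ(v)`. -/
def conjNeg (φ : ℕ → Formula L 0) : ℕ → Formula L 0
  | 0 => .top
  | u + 1 => .and (conjNeg φ u) (φ u).neg

/-- `φ(u, v⃗)` for numerals. -/
def instNum {k : ℕ} (φ : Formula L (k + 1)) (v : Fin k → ℕ) (u : ℕ) : Formula L 0 :=
  inst φ (fun i => numeral (v i)) (numeral u)

/-- The formula `F(e, u)`. -/
def PosOp.F (D : PosOp L) : CanExpr L → Val → Formula L 0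
  | .term φ v, .num u => (instNum φ v u).and (conjNeg (instNum φ v) u)
  | .form n, .tt => D.A (numeral n)
  | _, _ => .top

/-- `S` is correct. -/
def PosOp.Correct (D : PosOp L) (S : Sub L) : Prop := ∀ e u, S e = some u → S.bar.Sat (D.F e u)

/-- `S` is computationally inconsistent. -/
def PosOp.CI (D : PosOp L) (S : Sub L) : Prop :=
  (∃ e u, S e = some u ∧ S.Sat (D.F e u).neg) ∨
    ∃ n u, S (D.c n) = some u ∧ u ≠ .unk ∧ S (.form n) = some .tt

/-- `S` is solving. -/
def PosOp.Solving (D : PosOp L) {N : ℕ} (Cr : Fin (N + 1) → Critical L) (S : Sub L) : Prop :=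
  ∀ i, S.bar.Sat ((Cr i).toFormula D)

/-! Histories. The formula `n ∈ I` is represented by the number `n` in the sequence `P` and in the
domain of `V`. -/

/-- `(e, u)` belongs to the part `S⁻_{=Ω}` of every substitution `S` it is in. -/
def PosOp.NegPair (D : PosOp L) (e : CanExpr L) (u : Val) : Prop :=
  (∃ n, e = D.c n ∧ u ≠ .unk) ∨ (∃ n, e = .form n ∧ u = .unk)

/-- `(e, u)` belongs to the part `S⁺_{=Ω}` of every substitution `S` it is in. -/
def PosOp.PosPair (D : PosOp L) (e : CanExpr L) (u : Val) : Prop :=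
  (∃ n, e = D.c n ∧ u = .unk) ∨ (∃ n, e = .form n ∧ u = .tt)

open Classical in
/-- `S⁻_{=Ω}`. -/
def PosOp.negPart (D : PosOp L) (S : Sub L) : Sub L := fun e =>
  match S e with
  | some u => if D.NegPair e u then some u else none
  | none => none

/-- `P, V` is a substitution history. -/
def PosOp.IsHistory (D : PosOp L) (P : List ℕ) (V : ℕ → Option (Sub L)) : Prop :=
  P.Nodup ∧ (∀ n, (V n).isSome ↔ n ∈ P) ∧
    ∀ n T, V n = some T → T.IsSub ∧ T.dom.Finite ∧ D.negPart T = T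

open Classical in
/-- The substitution `{(m ∈ I, ⊤) | m in the list}`. -/
def topSub (l : List ℕ) : Sub L
  | .form m => if m ∈ l then some .tt else none
  | .term _ _ => none

/-- `P` is admissible. -/
def PosOp.Admissible (D : PosOp L) (P : List ℕ) : Prop :=
  ∀ l n l', P = l ++ n :: l' →
    (topSub l : Sub L).bar.Sat (D.B.subst ![numeral 0, numeral n])

/-! The `H`-step at a historical substitution `(S, P, V)`. -/

/-- The value of a closed term under the standard extension. -/
def Sub.ev (S : Sub L) (t : Term L 0) : ℕ := ((t.red S.bar).num?).getD 0

open Classical in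
/-- The first `n` in `P` with `¬φ(n, s⃗)` under the standard extension. -/
def firstFail {k : ℕ} (S : Sub L) (P : List ℕ) (φ : Formula L (k + 1)) (s : Fin k → Term L 0) :
    Option ℕ :=
  P.find? fun n => decide (S.bar.Sat (inst φ s (numeral n)).neg)

open Classical in
/-- The expression and the value which would repair a failing critical formula. -/
def PosOp.repair (D : PosOp L) (S : Sub L) (P : List ℕ) : Critical L → CanExpr L × Val
  | .pred s => (.term predMatrix (fun _ : Fin 1 => S.ev s), .num (S.ev s - 1))
  | .eps φ s t => (.term φ (fun i => S.ev (s i)), .num (S.ev t))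
  | .ind φ s t =>
      (.term (indStep φ) (fun i => S.ev (s i)),
        .num (sInf {m | m < S.ev t ∧ S.bar.Sat (inst φ s (numeral m)) ∧
          S.bar.Sat (inst φ s (numeral (m + 1))).neg}))
  | .inddef t => (.form (S.ev t), .tt)
  | .closure φ s =>
      let n := (firstFail S P φ s).getD 0
      if S.bar.Sat (D.Aφ φ s (numeral n)).neg then
        (D.c n, (S.bar (.term (D.Bφ φ).neg (Fin.cons n fun i => S.ev (s i)))).getD .unk)
      else (.term (D.prog φ).neg (fun i => S.ev (s i)), .num n)

/-- The closed term reduces to a numeral in `S` itself. -/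
def Sub.Computes (S : Sub L) (t : Term L 0) : Prop := (t.red S).num?.isSome

/-- The calculation of the expression and value repairing a failing critical formula takes place in
`S` itself. -/
def PosOp.RepairComputed (D : PosOp L) (S : Sub L) (P : List ℕ) : Critical L → Prop
  | .pred s => S.Computes s
  | .eps _ s t => (∀ i, S.Computes (s i)) ∧ S.Computes t
  | .ind φ s t => (∀ i, S.Computes (s i)) ∧ S.Computes t ∧
      ∀ m ≤ S.ev t, S.Decides (inst φ s (numeral m))
  | .inddef t => S.Computes t
  | .closure φ s => (∀ i, S.Computes (s i)) ∧
      ∃ l n l', P = l ++ n :: l' ∧ firstFail S P φ s = some n ∧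
        (∀ m ∈ l ++ [n], S.Decides (inst φ s (numeral m))) ∧
        S.Decides (D.Aφ φ s (numeral n)) ∧
        (S.Sat (D.Aφ φ s (numeral n)).neg →
          CanExpr.term (D.Bφ φ).neg (Fin.cons n fun i => S.ev (s i)) ∈ S.dom)

/-- `i` is the index chosen by the `H`-step: among the failing critical formulas the rank of the
repairing expression is least, and `i` is the least such index. -/
def PosOp.IsHIndex (D : PosOp L) {N : ℕ} (Cr : Fin (N + 1) → Critical L) (S : Sub L) (P : List ℕ)
    (i : Fin (N + 1)) : Prop :=
  ¬ S.bar.Sat ((Cr i).toFormula D) ∧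
    ∀ j, ¬ S.bar.Sat ((Cr j).toFormula D) →
      D.rk (D.repair S P (Cr i)).1 ≤ D.rk (D.repair S P (Cr j)).1 ∧
      (D.rk (D.repair S P (Cr j)).1 = D.rk (D.repair S P (Cr i)).1 → i ≤ j)

/-- The number `n` when `e` is `c_n` or `n ∈ I`. -/
def CanExpr.index : CanExpr L → ℕ
  | .form n => n
  | .term (k := k) _ v => if h : 0 < k then v ⟨0, h⟩ else 0

/-- Longest initial segment of `P` without `n`. -/
def before (P : List ℕ) (n : ℕ) : List ℕ := P.takeWhile (fun m => decide (m ≠ n))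

open Classical in
/-- The substitution component of `H(S, P, V)`, as a set of pairs, for `H`-expression `e` and
`H`-value `v`. -/
def PosOp.HS (D : PosOp L) (S : Sub L) (P : List ℕ) (V : ℕ → Option (Sub L)) (e : CanExpr L)
    (v : Val) : Set (CanExpr L × Val) :=
  if D.rk e ≠ Om then
    ({p ∈ S.graph | D.rk p.1 ≤ D.rk e} \ {(e, .unk)}) ∪ {(e, v)}
  else if e.IsTerm then
    {p ∈ S.graph | D.rk p.1 < Om} ∪
      ({p ∈ S.graph | ∃ m ∈ before P e.index, p = (D.c m, .unk)} ∪
        {p ∈ S.graph | ∃ m ∈ before P e.index, p = (.form m, .tt)}) ∪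
      (if e.index ∈ P then ((V e.index).getD fun _ => none).graph else (D.negPart S).graph) ∪
      {(e, v)}
  else
    {p ∈ S.graph | D.rk p.1 < Om} ∪ {p ∈ S.graph | D.PosPair p.1 p.2} ∪ {(e, .tt)}

open Classical in
/-- The sequence component of `H(S, P, V)`. -/
def PosOp.HP (D : PosOp L) (P : List ℕ) (e : CanExpr L) : List ℕ :=
  if D.rk e < Om then []
  else if Om < D.rk e then P
  else if e.IsTerm then before P e.index
  else P ++ [e.index]

open Classical in
/-- The history component of `H(S, P, V)`. -/
def PosOp.HV (D : PosOp L) (S : Sub L) (P : List ℕ) (V : ℕ → Option (Sub L)) (e : CanExpr L) :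
    ℕ → Option (Sub L) :=
  if D.rk e < Om then fun _ => none
  else if Om < D.rk e then V
  else if e.IsTerm then fun m => if m ∈ before P e.index then V m else none
  else Function.update V e.index (some (D.negPart S))

/-- The `H`-step applies to `(S, P, V)` with `H`-expression `e` and `H`-value `v`: `S` is correct
and nonsolving, and all calculations in the computation of `H(S, P, V)` take place in `S`. -/
def PosOp.HApplies (D : PosOp L) {N : ℕ} (Cr : Fin (N + 1) → Critical L) (S : Sub L) (P : List ℕ)
    (e : CanExpr L) (v : Val) : Prop :=
  D.Correct S ∧ ¬ D.Solving Cr S ∧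
  (∀ j, S.Decides ((Cr j).toFormula D)) ∧
  (∀ j, ¬ S.bar.Sat ((Cr j).toFormula D) → D.RepairComputed S P (Cr j)) ∧
  (∃ i, D.IsHIndex Cr S P i ∧ D.repair S P (Cr i) = (e, v)) ∧
  S e = some .unk ∧
  (∀ n, e = D.c n → .form n ∈ S.dom) ∧
  (∀ n, e = .form n → D.c n ∈ S.dom) ∧
  (e.IsTerm → D.rk e = Om → ∀ m, S (D.c m) = some .unk → .form m ∈ S.dom)

/-- `e'` is active at `(S, P, V)`, for `H`-expression `e` and `H`-value `v`. -/
def PosOp.Active (D : PosOp L) (S : Sub L) (P : List ℕ) (V : ℕ → Option (Sub L)) (e : CanExpr L)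
    (v : Val) (e' : CanExpr L) : Prop :=
  e' ∈ S.dom ∧ D.rk e' = D.rk e ∧
    ((∀ u, (e', u) ∉ D.HS S P V e v) ∨ ∃ u, (e', u) ∈ D.HS S P V e v ∧ S e' ≠ some u)

end Semantics

/-! Sequents and the deduction system. -/

/-- The data `(S, P, V, F)` of a sequent; the labels `t`, `f` are `true`, `false`. -/
structure Sequent (L : FirstOrder.Language.{0, 0}) : Type where
  S : Sub L
  P : List ℕ
  V : ℕ → Option (Sub L)
  F : CanExpr L → Option Bool

/-- The expressions that carry a label. -/
def PosOp.Labelled (D : PosOp L) (S : Sub L) (e : CanExpr L) : Prop :=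
  S e = some .unk ∨ (e ∈ S.dom ∧ D.rk e = Om)

/-- `(S, P, V)` is a historical substitution and `F` labels exactly the expressions of value `?` or
of rank `Ω`. -/
def PosOp.IsSequent (D : PosOp L) (Θ : Sequent L) : Prop :=
  Θ.S.IsSub ∧ D.IsHistory Θ.P Θ.V ∧ (∀ n, n ∈ Θ.P ↔ Θ.S (.form n) = some .tt) ∧
    ∀ e, (Θ.F e).isSome ↔ D.Labelled Θ.S e

/-- The empty sequent. -/
def Sequent.empty : Sequent L where
  S := fun _ => none
  P := []
  V := fun _ => none
  F := fun _ => none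

open Classical in
/-- `(e, u), Θ`. -/
def Sequent.add (Θ : Sequent L) (e : CanExpr L) (u : Val) : Sequent L where
  S := Function.update Θ.S e (some u)
  P := Θ.P
  V := Θ.V
  F := Θ.F

open Classical in
/-- `(e, u, i), Θ`. -/
def Sequent.addL (Θ : Sequent L) (e : CanExpr L) (u : Val) (i : Bool) : Sequent L where
  S := Function.update Θ.S e (some u)
  P := Θ.P
  V := Θ.V
  F := Function.update Θ.F e (some i)

open Classical in
/-- `(e, ⊤, i, P_e, V_e), Θ`. -/
def Sequent.addTop (Θ : Sequent L) (i : Bool) (Pe : List ℕ) (Ve : ℕ → Option (Sub L)) :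
    Sequent L where
  S := fun e => if ∃ m ∈ Pe, e = .form m then some .tt else Θ.S e
  P := Θ.P ++ Pe
  V := fun m => if m ∈ Pe then Ve m else Θ.V m
  F := fun e => if ∃ m ∈ Pe, e = .form m then some i else Θ.F e

section Deductions

variable [L.Structure ℕ]

/-- `P_e` is proper for `n ∈ I` and `Θ`. The formulas of `P_e` are not in the domain of `Θ`. -/
def PosOp.Proper (D : PosOp L) (n : ℕ) (Θ : Sequent L) (Pe : List ℕ) : Prop :=
  Pe.Nodup ∧ (∀ m ∈ Pe, ∀ u, Θ.S (D.c m) = some u → u = .unk) ∧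
    D.Admissible (Θ.P ++ Pe) ∧ Pe.getLast? = some n ∧
    (∀ m ∈ Pe, m ∉ Θ.P) ∧ ∀ m ∈ Pe, .form m ∉ Θ.S.dom

/-- `Ψ` is `H(Θ)`, for `H`-expression `e` and `H`-value `v`. -/
def PosOp.IsH (D : PosOp L) (Θ Ψ : Sequent L) (e : CanExpr L) (v : Val) : Prop :=
  Ψ.S.graph = D.HS Θ.S Θ.P Θ.V e v ∧ Ψ.P = D.HP Θ.P e ∧ Ψ.V = D.HV Θ.S Θ.P Θ.V e ∧
    ∀ e', (¬ D.Labelled Ψ.S e' → Ψ.F e' = none) ∧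
      (D.Labelled Ψ.S e' → e' ∈ Θ.S.dom → Ψ.F e' = Θ.F e') ∧
      (D.Labelled Ψ.S e' → e' ∉ Θ.S.dom → Ψ.F e' = some true)

/-- The axioms `AxF`, `AxS`, `AxH`. -/
def PosOp.IsAxiom (D : PosOp L) {N : ℕ} (Cr : Fin (N + 1) → Critical L) (Θ : Sequent L) : Prop :=
  D.CI Θ.S ∨ D.Solving Cr Θ.S ∨
    ∃ e v, D.HApplies Cr Θ.S Θ.P e v ∧
      ∃ e', D.Active Θ.S Θ.P Θ.V e v e' ∧ Θ.F e' = some false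

/-- Names of inference rules, with their main expression. -/
inductive Rule (L : FirstOrder.Language.{0, 0}) : Type
  | cut (e : CanExpr L) : Rule L
  | cutFr (e : CanExpr L) : Rule L
  | cutOmTerm (e : CanExpr L) : Rule L
  | cutFrOmTerm (e : CanExpr L) : Rule L
  | cutOmForm (n : ℕ) : Rule L
  | fr (e : CanExpr L) : Rule L
  | h (e : CanExpr L) (v : Val) : Rule L

/-- The side condition for the rule to be applied with conclusion `Θ`. -/
def PosOp.Applicable (D : PosOp L) {N : ℕ} (Cr : Fin (N + 1) → Critical L) (Θ : Sequent L) :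
    Rule L → Prop
  | .cut e => e.IsCanonical ∧ e.IsTerm ∧ D.rk e ≠ Om ∧ e ∉ Θ.S.dom
  | .cutFr e => e.IsCanonical ∧ e.IsTerm ∧ D.rk e ≠ Om ∧ e ∉ Θ.S.dom
  | .cutOmTerm e => e.IsCanonical ∧ e.IsTerm ∧ D.rk e = Om ∧ e ∉ Θ.S.dom
  | .cutFrOmTerm e => e.IsCanonical ∧ e.IsTerm ∧ D.rk e = Om ∧ e ∉ Θ.S.dom
  | .cutOmForm n => .form n ∉ Θ.S.dom
  | .fr e => e.IsCanonical ∧ e ∉ Θ.S.dom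
  | .h e v => D.HApplies Cr Θ.S Θ.P e v ∧ Θ.F e = some true ∧
      (∀ e', D.Active Θ.S Θ.P Θ.V e v e' → Θ.F e' = some true) ∧
      ∃ Ψ, D.IsH Θ Ψ e v

/-- `Ψ` is one of the premises of the rule with conclusion `Θ`. -/
def PosOp.IsPremise (D : PosOp L) (Θ Ψ : Sequent L) : Rule L → Prop
  | .cut e => Ψ = Θ.addL e .unk false ∨ ∃ u, 0 < u ∧ Ψ = Θ.add e (.num u)
  | .cutFr e => Ψ = Θ.addL e .unk true ∨ ∃ u, 0 < u ∧ Ψ = Θ.add e (.num u)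
  | .cutOmTerm e => Ψ = Θ.addL e .unk false ∨ ∃ u, 0 < u ∧ Ψ = Θ.addL e (.num u) false
  | .cutFrOmTerm e => Ψ = Θ.addL e .unk true ∨ ∃ u, 0 < u ∧ Ψ = Θ.addL e (.num u) false
  | .cutOmForm n => Ψ = Θ.addL (.form n) .unk false ∨
      ∃ Pe Ve, D.Proper n Θ Pe ∧ D.IsHistory Pe Ve ∧ Ψ = Θ.addTop false Pe Ve
  | .fr e => Ψ = Θ.addL e .unk true
  | .h e v => D.IsH Θ Ψ e v

/-- Deductions of `Θ` from the set `T` of sequents: well-founded trees of sequents. -/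
inductive Deduction (D : PosOp L) {N : ℕ} (Cr : Fin (N + 1) → Critical L) (T : Set (Sequent L)) :
    Sequent L → Type
  | hyp (Θ : Sequent L) (hs : D.IsSequent Θ) (h : Θ ∈ T) : Deduction D Cr T Θ
  | ax (Θ : Sequent L) (hs : D.IsSequent Θ) (h : D.IsAxiom Cr Θ) : Deduction D Cr T Θ
  | inf (Θ : Sequent L) (hs : D.IsSequent Θ) (R : Rule L) (h : D.Applicable Cr Θ R)
      (d : ∀ Ψ, D.IsPremise Θ Ψ R → Deduction D Cr T Ψ) : Deduction D Cr T Θ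

/-- Every inference in the deduction has the property `p`. -/
def Deduction.AllRules {D : PosOp L} {N : ℕ} {Cr : Fin (N + 1) → Critical L}
    {T : Set (Sequent L)} (p : Rule L → Prop) : {Θ : Sequent L} → Deduction D Cr T Θ → Prop
  | _, .hyp _ _ _ => True
  | _, .ax _ _ _ => True
  | _, .inf _ _ R _ d => p R ∧ ∀ Ψ hΨ, (d Ψ hΨ).AllRules p

/-- Derivations: deductions from the empty set. -/
abbrev Derivation (D : PosOp L) {N : ℕ} (Cr : Fin (N + 1) → Critical L) (Θ : Sequent L) : Type :=
  Deduction D Cr ∅ Θ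

/-- The rule is one of the three `Cut` rules, and its main expression has rank at most `r`. -/
def PosOp.IsCutLE (D : PosOp L) (r : Ordinal.{0}) : Rule L → Prop
  | .cut e => D.rk e ≤ r
  | .cutOmTerm e => D.rk e ≤ r
  | .cutOmForm n => D.rk (.form n) ≤ r
  | .cutFr _ => False
  | .cutFrOmTerm _ => False
  | .fr _ => False
  | .h _ _ => False

/-- `F(Θ, C)`. -/
def PosOp.FSet (D : PosOp L) (Θ : Sequent L) (C : Set (Formula L 0)) : Set (Formula L 0) :=
  C ∪ {φ | ∃ e u, Θ.S e = some u ∧ e.IsTerm ∧ φ = D.F e u}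

/-- `ρ(Θ, C)`, the maximal simple rank of `|φ|_{Θ_S}` for `φ ∈ F(Θ, C)` (finite sets only). -/
def PosOp.rho (D : PosOp L) (Θ : Sequent L) (C : Set (Formula L 0)) : ℕ :=
  sSup {m | ∃ φ ∈ D.FSet Θ C, m = (φ.red Θ.S).rkS}

end Deductions

end EpsID1

end

/-!
By `Cut`s, any finite list of canonical terms and formulas `n ∈ I` may be assumed to lie in the
domain of the sequent to be derived. Deciding a formula of simple rank `r` takes cuts on terms
`c_{∃xφ}(n⃗)` with `rk_s(φ) < r`, hence of rank at most `Ω + r + 1`, and on formulas `n ∈ I`. Each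
time a term `e` receives a value `u`, further cuts decide `F(e, u)`; this terminates because
`F(e, u)` has smaller simple rank than `e`. Likewise `n ∈ I` is decided whenever `c_n` is.

Starting from `∅`, cut until every critical formula is decided together with all that is needed to
repair it. If the resulting sequent is not computationally inconsistent then it is correct: all
`F(e, u)` are decided, and `A(n, I)` holds for `(n ∈ I, ⊤)` by admissibility of the history. If it
is not solving either, the `H`-step applies and changes a labelled expression: its `H`-expression,
or, when a Closure formula is repaired at `c_n`, the formula `n ∈ I`, which leaves the history.
Every label is `f`, since the `Cut`s used introduce no other, so `AxH` applies.
-/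

noncomputable section

namespace EpsID1

variable {L : FirstOrder.Language.{0, 0}}

/-! ### Numerals and substitution -/

-- `Term` and `Formula` are mutually inductive because the name of a Skolem function is a formula.
-- The two principles below leave the names alone, as substitution and evaluation do.
@[induction_eliminator]
theorem Term.ind {n : ℕ} {p : Term L n → Prop} (var : ∀ i, p (.var i)) (zero : p .zero)
    (succ : ∀ t, p t → p (.succ t))
    (func : ∀ (k : ℕ) (f : L.Functions k) (ts : Fin k → Term L n), (∀ i, p (ts i)) →
      p (.func f ts))
    (skol : ∀ (k : ℕ) (φ : Formula L (k + 1)) (ts : Fin k → Term L n), (∀ i, p (ts i)) →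
      p (.skol φ ts)) : ∀ t, p t
  | .var i => var i
  | .zero => zero
  | .succ t => succ t (Term.ind var zero succ func skol t)
  | .func f ts => func _ f ts fun i => Term.ind var zero succ func skol (ts i)
  | .skol φ ts => skol _ φ ts fun i => Term.ind var zero succ func skol (ts i)

@[induction_eliminator]
theorem Formula.ind {n : ℕ} {p : Formula L n → Prop} (top : p .top) (bot : p .bot)
    (eq : ∀ s t, p (.eq s t))
    (rel : ∀ (k : ℕ) (R : L.Relations k) (ts : Fin k → Term L n), p (.rel R ts))
    (mem : ∀ t, p (.mem t)) (neg : ∀ φ, p φ → p (.neg φ))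
    (and : ∀ φ ψ, p φ → p ψ → p (.and φ ψ)) (or : ∀ φ ψ, p φ → p ψ → p (.or φ ψ)) : ∀ φ, p φ
  | .top => top
  | .bot => bot
  | .eq s t => eq s t
  | .rel R ts => rel _ R ts
  | .mem t => mem t
  | .neg φ => neg φ (Formula.ind top bot eq rel mem neg and or φ)
  | .and φ ψ => and φ ψ (Formula.ind top bot eq rel mem neg and or φ)
      (Formula.ind top bot eq rel mem neg and or ψ)
  | .or φ ψ => or φ ψ (Formula.ind top bot eq rel mem neg and or φ)
      (Formula.ind top bot eq rel mem neg and or ψ)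

@[simp] theorem num?_numeral {n : ℕ} (m : ℕ) : (numeral m : Term L n).num? = some m := by
  induction m <;> simp_all [numeral, Term.num?]

theorem num?_eq_some {n : ℕ} {t : Term L n} {m : ℕ} : t.num? = some m ↔ t = numeral m := by
  refine ⟨fun h => ?_, fun h => h ▸ num?_numeral m⟩
  induction t generalizing m with
  | zero => cases h; rfl
  | succ t ih =>
    obtain ⟨k, hk, rfl⟩ := Option.map_eq_some_iff.1 h
    rw [ih hk, numeral]
  | var | func | skol => cases h

theorem nums?_eq_some {n k : ℕ} {ts : Fin k → Term L n} {v : Fin k → ℕ} :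
    nums? ts = some v ↔ ∀ i, ts i = numeral (v i) := by
  refine ⟨fun h i => ?_, fun h => by simp [nums?, h]⟩
  rw [nums?] at h
  split_ifs at h with hs
  cases h
  obtain ⟨m, hm⟩ := Option.isSome_iff_exists.1 (hs i)
  simp [num?_eq_some.1 hm]

@[simp] theorem numeral_noSkol {n : ℕ} (m : ℕ) : (numeral m : Term L n).NoSkol := by
  induction m <;> simp_all [numeral, Term.NoSkol]

@[simp] theorem numeral_not_hasI {n : ℕ} (m : ℕ) : ¬ (numeral m : Term L n).HasI := by
  induction m <;> simp_all [numeral, Term.HasI]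

@[simp] theorem val_numeral [L.Structure ℕ] {n : ℕ} (x : Fin n → ℕ) (m : ℕ) :
    (numeral m : Term L n).val x = m := by
  induction m <;> simp_all [numeral, Term.val]

theorem Term.NoSkol.wf {n : ℕ} {t : Term L n} (ht : t.NoSkol) : t.WF := by
  induction t <;> simp_all [Term.NoSkol, Term.WF]

theorem Formula.NoSkol.wf {n : ℕ} {φ : Formula L n} (hφ : φ.NoSkol) : φ.WF := by
  induction φ <;> simp_all [Formula.NoSkol, Formula.WF, Term.NoSkol.wf]

theorem Term.NoSkol.rkS_eq_zero {n : ℕ} {t : Term L n} (ht : t.NoSkol) : t.rkS = 0 := by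
  induction t <;> simp_all [Term.NoSkol, Term.rkS]

theorem Formula.NoSkol.rkS_eq_zero {n : ℕ} {φ : Formula L n} (hφ : φ.NoSkol) : φ.rkS = 0 := by
  induction φ <;> simp_all [Formula.NoSkol, Formula.rkS, Term.NoSkol.rkS_eq_zero]

@[simp] theorem numeral_wf {n : ℕ} (m : ℕ) : (numeral m : Term L n).WF := (numeral_noSkol m).wf

@[simp] theorem numeral_rkS {n : ℕ} (m : ℕ) : (numeral m : Term L n).rkS = 0 :=
  (numeral_noSkol m).rkS_eq_zero

theorem Term.WF.subst {n m : ℕ} {σ : Fin n → Term L m} (hσ : ∀ i, (σ i).WF) {t : Term L n}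
    (ht : t.WF) : (t.subst σ).WF := by
  induction t <;> simp_all [Term.subst, Term.WF]

theorem Formula.WF.subst {n m : ℕ} {σ : Fin n → Term L m} (hσ : ∀ i, (σ i).WF) {φ : Formula L n}
    (hφ : φ.WF) : (φ.subst σ).WF := by
  induction φ <;> simp_all [Formula.subst, Formula.WF, Term.WF.subst hσ]

theorem Term.NoSkol.subst {n m : ℕ} {σ : Fin n → Term L m} (hσ : ∀ i, (σ i).NoSkol)
    {t : Term L n} (ht : t.NoSkol) : (t.subst σ).NoSkol := by
  induction t <;> simp_all [Term.subst, Term.NoSkol]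

theorem Formula.NoSkol.subst {n m : ℕ} {σ : Fin n → Term L m} (hσ : ∀ i, (σ i).NoSkol)
    {φ : Formula L n} (hφ : φ.NoSkol) : (φ.subst σ).NoSkol := by
  induction φ <;> simp_all [Formula.subst, Formula.NoSkol, Term.NoSkol.subst hσ]

theorem Term.rkS_subst_le {n m r : ℕ} {σ : Fin n → Term L m} (hσ : ∀ i, (σ i).rkS ≤ r)
    {t : Term L n} (ht : t.rkS ≤ r) : (t.subst σ).rkS ≤ r := by
  induction t <;> simp_all [Term.subst, Term.rkS]

theorem Formula.rkS_subst_le {n m r : ℕ} {σ : Fin n → Term L m} (hσ : ∀ i, (σ i).rkS ≤ r)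
    {φ : Formula L n} (hφ : φ.rkS ≤ r) : (φ.subst σ).rkS ≤ r := by
  induction φ <;> simp_all [Formula.subst, Formula.rkS, Term.rkS_subst_le hσ]

theorem Term.Simple.not_closed {n : ℕ} {t : Term L n} (ht : t.Simple) : ¬ t.Closed := by
  induction t with
  | var i => exact id
  | zero => exact ht.elim
  | succ t ih => exact ih ht
  | func k f ts => exact ht.1
  | skol k φ ts => exact ht.1

theorem Term.closed_of_subst {n m : ℕ} {σ : Fin n → Term L m} (hσ : ∀ i, ¬ (σ i).Closed)
    {t : Term L n} (ht : (t.subst σ).Closed) : t.Closed := by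
  induction t <;> simp_all [Term.subst, Term.Closed]

theorem Term.Simple.subst {n m : ℕ} {σ : Fin n → Term L m} (hσ : ∀ i, (σ i).Simple)
    {t : Term L n} (ht : t.Simple) : (t.subst σ).Simple := by
  have not_closed {u : Term L n} (hu : ¬ u.Closed) : ¬ (u.subst σ).Closed :=
    mt (Term.closed_of_subst fun i => (hσ i).not_closed) hu
  induction t with
  | var i => exact hσ i
  | zero => exact ht.elim
  | succ t ih => exact ih ht
  | func k f ts ih => exact ⟨not_closed ht.1, fun i => ih i (ht.2 i)⟩
  | skol k φ ts ih => exact ⟨not_closed ht.1, fun i => ih i (ht.2 i)⟩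

theorem Formula.Simple.subst {n m : ℕ} {σ : Fin n → Term L m} (hσ : ∀ i, (σ i).Simple)
    {φ : Formula L n} (hφ : φ.Simple) : (φ.subst σ).Simple := by
  induction φ <;> simp_all [Formula.subst, Formula.Simple, Term.Simple.subst hσ]

theorem Formula.Simple.plug {n : ℕ} {χ : Term L n → Formula L n}
    (hχ : ∀ t : Term L n, t.Simple → (χ t).Simple) {φ : Formula L n} (hφ : φ.Simple) :
    (φ.plug χ).Simple := by
  induction φ <;> simp_all [Formula.plug, Formula.Simple]

theorem Formula.WF.plug {n : ℕ} {χ : Term L n → Formula L n}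
    (hχ : ∀ t : Term L n, t.WF → (χ t).WF) {φ : Formula L n} (hφ : φ.WF) :
    (φ.plug χ).WF := by
  induction φ <;> simp_all [Formula.plug, Formula.WF]

theorem Formula.NoSkol.rkS_plug_le {n r : ℕ} {χ : Term L n → Formula L n}
    (hχ : ∀ t : Term L n, t.NoSkol → (χ t).rkS ≤ r) {φ : Formula L n} (hφ : φ.NoSkol) :
    (φ.plug χ).rkS ≤ r := by
  induction φ <;>
    simp_all [Formula.plug, Formula.NoSkol, Formula.rkS, Term.NoSkol.rkS_eq_zero]

/-- The variable `j` occurs in the term; names of Skolem functions have no free variables and are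
not inspected. -/
def Term.Occ {n : ℕ} (j : Fin n) : Term L n → Prop
  | .var i => i = j
  | .zero => False
  | .succ t => t.Occ j
  | .func _ ts => ∃ i, (ts i).Occ j
  | .skol _ ts => ∃ i, (ts i).Occ j

/-- The variable `j` occurs in the formula. -/
def Formula.Occ {n : ℕ} (j : Fin n) : Formula L n → Prop
  | .top => False
  | .bot => False
  | .eq s t => s.Occ j ∨ t.Occ j
  | .rel _ ts => ∃ i, (ts i).Occ j
  | .mem t => t.Occ j
  | .neg φ => φ.Occ j
  | .and φ ψ => φ.Occ j ∨ ψ.Occ j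
  | .or φ ψ => φ.Occ j ∨ ψ.Occ j

theorem Term.Occ.rkS_le_subst {n m : ℕ} {σ : Fin n → Term L m} {j : Fin n} {t : Term L n}
    (ht : t.Occ j) : (σ j).rkS ≤ (t.subst σ).rkS := by
  induction t with
  | var i => cases ht; exact le_rfl
  | zero => exact ht.elim
  | succ t ih => simpa only [Term.subst, Term.rkS] using ih ht
  | func k f ts ih =>
    obtain ⟨i, hi⟩ := ht
    simpa only [Term.subst, Term.rkS] using
      Finset.le_sup_of_le (Finset.mem_univ i) (ih i hi)
  | skol k φ ts ih =>
    obtain ⟨i, hi⟩ := ht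
    simpa only [Term.subst, Term.rkS] using
      le_max_of_le_right (Finset.le_sup_of_le (Finset.mem_univ i) (ih i hi))

theorem Formula.Occ.rkS_le_subst {n m : ℕ} {σ : Fin n → Term L m} {j : Fin n} {φ : Formula L n}
    (h : φ.Occ j) : (σ j).rkS ≤ (φ.subst σ).rkS := by
  induction φ with
  | top | bot => exact h.elim
  | eq s t =>
    simpa only [Formula.subst, Formula.rkS, le_max_iff] using
      h.imp Term.Occ.rkS_le_subst Term.Occ.rkS_le_subst
  | rel k R ts =>
    obtain ⟨i, hi⟩ := h
    simpa only [Formula.subst, Formula.rkS] using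
      Finset.le_sup_of_le (Finset.mem_univ i) hi.rkS_le_subst
  | mem t => simpa only [Formula.subst, Formula.rkS] using Term.Occ.rkS_le_subst h
  | neg φ ih => simpa only [Formula.subst, Formula.rkS] using ih h
  | and φ ψ ih ih' => simpa only [Formula.subst, Formula.rkS, le_max_iff] using h.imp ih ih'
  | or φ ψ ih ih' => simpa only [Formula.subst, Formula.rkS, le_max_iff] using h.imp ih ih'

/-- `S ⊆ T` as sets of pairs. -/
def Sub.Le (S T : Sub L) : Prop := ∀ e u, S e = some u → T e = some u

theorem Sub.Le.eq_of_mem_dom {S T : Sub L} (h : S.Le T) {e : CanExpr L} (he : e ∈ S.dom) :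
    T e = S e := by
  obtain ⟨u, hu⟩ := Option.isSome_iff_exists.1 he
  rw [hu, h e u hu]

theorem Sub.Le.mem_dom {S T : Sub L} (h : S.Le T) {e : CanExpr L} (he : e ∈ S.dom) :
    e ∈ T.dom :=
  (congrArg Option.isSome (h.eq_of_mem_dom he)).trans he

theorem mem_dom_bar {S : Sub L} {e : CanExpr L} (h : e.IsCanonical) : e ∈ S.bar.dom := by
  rcases hS : S e with _ | u <;> simp [Sub.dom, Sub.bar, hS, h]

theorem bar_eq_some_iff {S : Sub L} {e : CanExpr L} {u : Val} (hu : u ≠ .unk) :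
    S.bar e = some u ↔ S e = some u := by
  rcases hS : S e with _ | w
  · by_cases hc : e.IsCanonical <;> simp [Sub.bar, hS, hc, hu.symm]
  · simp [Sub.bar, hS]

/-! ### Evaluation -/

section Semantics

variable [L.Structure ℕ]

/-- The value of a term at `x`, with `?` and missing values of `S` read as `0`. -/
def Term.eval {n : ℕ} (S : Sub L) (x : Fin n → ℕ) : Term L n → ℕ
  | .var i => x i
  | .zero => 0
  | .succ t => t.eval S x + 1
  | .func f ts => FirstOrder.Language.Structure.funMap f (fun i => (ts i).eval S x)
  | .skol φ ts =>
      match S (.term φ (fun i => (ts i).eval S x)) with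
      | some (.num m) => m
      | _ => 0

/-- The truth value of a formula at `x`, with `?` and missing values of `S` read as `0` and `⊥`. -/
def Formula.TrueIn {n : ℕ} (S : Sub L) (x : Fin n → ℕ) : Formula L n → Prop
  | .top => True
  | .bot => False
  | .eq s t => s.eval S x = t.eval S x
  | .rel R ts => FirstOrder.Language.Structure.RelMap R (fun i => (ts i).eval S x)
  | .mem t => S (.form (t.eval S x)) = some .tt
  | .neg φ => ¬ φ.TrueIn S x
  | .and φ ψ => φ.TrueIn S x ∧ ψ.TrueIn S x
  | .or φ ψ => φ.TrueIn S x ∨ ψ.TrueIn S x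

@[simp] theorem Formula.trueIn_imp {n : ℕ} (S : Sub L) (x : Fin n → ℕ) (φ ψ : Formula L n) :
    (φ.imp ψ).TrueIn S x ↔ (φ.TrueIn S x → ψ.TrueIn S x) := by
  simp [Formula.imp, Formula.TrueIn, imp_iff_not_or]

@[simp] theorem eval_numeral {n : ℕ} (S : Sub L) (x : Fin n → ℕ) (m : ℕ) :
    (numeral m : Term L n).eval S x = m := by
  induction m <;> simp_all [numeral, Term.eval]

@[simp] theorem Term.eval_subst {n m : ℕ} (S : Sub L) (x : Fin m → ℕ) (σ : Fin n → Term L m)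
    (t : Term L n) : (t.subst σ).eval S x = t.eval S fun i => (σ i).eval S x := by
  induction t <;> simp_all [Term.subst, Term.eval]

@[simp] theorem Formula.trueIn_subst {n m : ℕ} (S : Sub L) (x : Fin m → ℕ)
    (σ : Fin n → Term L m) (φ : Formula L n) :
    (φ.subst σ).TrueIn S x ↔ φ.TrueIn S fun i => (σ i).eval S x := by
  induction φ <;> simp_all [Formula.subst, Formula.TrueIn]

theorem Term.eval_congr {n : ℕ} {S : Sub L} {x y : Fin n → ℕ} {t : Term L n}
    (h : ∀ j, t.Occ j → x j = y j) : t.eval S x = t.eval S y := by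
  induction t with
  | var i => exact h i rfl
  | zero => rfl
  | succ t ih => exact congrArg (· + 1) (ih h)
  | func k f ts ih =>
    simp only [Term.eval, fun i => ih i fun j hj => h j ⟨i, hj⟩]
  | skol k φ ts ih =>
    simp only [Term.eval, fun i => ih i fun j hj => h j ⟨i, hj⟩]

theorem Formula.trueIn_congr {n : ℕ} {S : Sub L} {x y : Fin n → ℕ} {φ : Formula L n}
    (h : ∀ j, φ.Occ j → x j = y j) : φ.TrueIn S x ↔ φ.TrueIn S y := by
  induction φ with
  | top | bot => rfl
  | eq s t =>
    simp only [Formula.TrueIn, Term.eval_congr fun j hj => h j (Or.inl hj),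
      Term.eval_congr fun j hj => h j (Or.inr hj)]
  | rel k R ts =>
    simp only [Formula.TrueIn,
      fun i => Term.eval_congr (S := S) (t := ts i) (x := x) (y := y) fun j hj => h j ⟨i, hj⟩]
  | mem t => simp only [Formula.TrueIn, Term.eval_congr h]
  | neg φ ih => exact not_congr (ih h)
  | and φ ψ ih ih' =>
    exact and_congr (ih fun j hj => h j (Or.inl hj)) (ih' fun j hj => h j (Or.inr hj))
  | or φ ψ ih ih' =>
    exact or_congr (ih fun j hj => h j (Or.inl hj)) (ih' fun j hj => h j (Or.inr hj))

theorem Formula.trueIn_cons_congr {k : ℕ} {S : Sub L} {φ : Formula L (k + 1)} (h : ¬ φ.Occ 0)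
    (a b : ℕ) (x : Fin k → ℕ) :
    φ.TrueIn S (Fin.cons a x : Fin (k + 1) → ℕ) ↔
      φ.TrueIn S (Fin.cons b x : Fin (k + 1) → ℕ) :=
  Formula.trueIn_congr <| Fin.cases (fun h₀ => (h h₀).elim) fun _ _ => rfl

theorem Term.NoSkol.eval_eq {n : ℕ} {t : Term L n} (ht : t.NoSkol) (S T : Sub L)
    (x : Fin n → ℕ) : t.eval S x = t.eval T x := by
  induction t <;> simp_all [Term.NoSkol, Term.eval]

theorem Formula.TrueIn.mono_of_polar {n : ℕ} {S T : Sub L}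
    (h : ∀ m, S (.form m) = some .tt → T (.form m) = some .tt) {x : Fin n → ℕ} {φ : Formula L n}
    (hφ : φ.NoSkol) : (φ.Polar true → φ.TrueIn S x → φ.TrueIn T x) ∧
      (φ.Polar false → φ.TrueIn T x → φ.TrueIn S x) := by
  induction φ with
  | top | bot => simp [Formula.TrueIn]
  | eq s t => simp [Formula.TrueIn, hφ.1.eval_eq S T, hφ.2.eval_eq S T]
  | rel k R ts => simp [Formula.TrueIn, fun i => (hφ i).eval_eq S T]
  | mem t =>
    simp only [Formula.TrueIn, Formula.Polar, Term.NoSkol.eval_eq hφ S T]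
    exact ⟨fun _ => h _, by simp⟩
  | neg φ ih => exact ⟨fun hp => mt ((ih hφ).2 hp), fun hp => mt ((ih hφ).1 hp)⟩
  | and φ ψ ih ih' =>
    exact ⟨fun hp => And.imp ((ih hφ.1).1 hp.1) ((ih' hφ.2).1 hp.2),
      fun hp => And.imp ((ih hφ.1).2 hp.1) ((ih' hφ.2).2 hp.2)⟩
  | or φ ψ ih ih' =>
    exact ⟨fun hp => Or.imp ((ih hφ.1).1 hp.1) ((ih' hφ.2).1 hp.2),
      fun hp => Or.imp ((ih hφ.1).2 hp.1) ((ih' hφ.2).2 hp.2)⟩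

/-! ### Reduction -/

theorem Term.red_func_of_numeral {n k : ℕ} {S : Sub L} {f : L.Functions k}
    {ts : Fin k → Term L n} {v : Fin k → ℕ} (h : ∀ i, (ts i).red S = numeral (v i)) :
    (Term.func f ts).red S = numeral (FirstOrder.Language.Structure.funMap f v) := by
  simp only [Term.red, nums?_eq_some.2 h]

theorem Term.red_skol_of_mem_dom {n k : ℕ} {S : Sub L} {φ : Formula L (k + 1)}
    {ts : Fin k → Term L n} {v : Fin k → ℕ} (h : ∀ i, (ts i).red S = numeral (v i))
    (hd : .term φ v ∈ S.dom) :
    (Term.skol φ ts).red S = numeral (match S (.term φ v) with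
      | some (.num m) => m
      | _ => 0) := by
  obtain ⟨u, hu⟩ := Option.isSome_iff_exists.1 hd
  simp only [Term.red, nums?_eq_some.2 h, hu]
  cases u <;> rfl

theorem Formula.red_mem_of_numeral {n : ℕ} {S : Sub L} {t : Term L n} {m : ℕ}
    (h : t.red S = numeral m) :
    (Formula.mem t).red S = match S (.form m) with
      | some .tt => .top
      | some _ => .bot
      | none => .mem (t.red S) := by
  simp only [Formula.red, h, num?_numeral]

theorem Term.red_func_cases {n k : ℕ} (S : Sub L) (f : L.Functions k) (ts : Fin k → Term L n) :
    (∃ v : Fin k → ℕ, ∀ i, (ts i).red S = numeral (v i)) ∨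
      (Term.func f ts).red S = .func f (fun i => (ts i).red S) := by
  rcases h : nums? (fun i => (ts i).red S) with _ | v
  · exact .inr (by simp only [Term.red, h])
  · exact .inl ⟨v, nums?_eq_some.1 h⟩

theorem Term.red_skol_cases {n k : ℕ} (S : Sub L) (φ : Formula L (k + 1))
    (ts : Fin k → Term L n) :
    (∃ v : Fin k → ℕ, (∀ i, (ts i).red S = numeral (v i)) ∧ .term φ v ∈ S.dom) ∨
      (Term.skol φ ts).red S = .skol φ (fun i => (ts i).red S) := by
  rcases h : nums? (fun i => (ts i).red S) with _ | v
  · exact .inr (by simp only [Term.red, h])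
  · rcases hd : S (.term φ v) with _ | u
    · exact .inr (by simp only [Term.red, h, hd])
    · exact .inl ⟨v, nums?_eq_some.1 h, by simp [Sub.dom, hd]⟩

theorem Term.red_eq_numeral {S : Sub L} {t : Term L 0} (h : (t.red S).NoSkol) :
    t.red S = numeral (t.eval S Fin.elim0) := by
  induction t with
  | var i => exact i.elim0
  | zero => rfl
  | succ t ih => exact congrArg Term.succ (ih h)
  | func k f ts ih =>
    refine red_func_of_numeral fun i => ih i ?_
    rcases Term.red_func_cases S f ts with ⟨v, hv⟩ | h'
    · simp [hv i]
    · exact (h' ▸ h :) i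
  | skol k φ ts ih =>
    rcases Term.red_skol_cases S φ ts with ⟨v, hv, hd⟩ | h'
    · obtain rfl : v = fun i => (ts i).eval S Fin.elim0 := funext fun i => by
        simpa using congrArg Term.num? ((hv i).symm.trans (ih i (by simp [hv i])))
      rw [red_skol_of_mem_dom hv hd, Term.eval]
    · exact (h' ▸ h :).elim

theorem computes_iff_noSkol {S : Sub L} {t : Term L 0} : S.Computes t ↔ (t.red S).NoSkol := by
  refine ⟨fun h => ?_, fun h => by simp [Sub.Computes, Term.red_eq_numeral h]⟩
  obtain ⟨m, hm⟩ := Option.isSome_iff_exists.1 h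
  simp [num?_eq_some.1 hm]

theorem Sub.Computes.red_eq {S : Sub L} {t : Term L 0} (h : S.Computes t) :
    t.red S = numeral (t.eval S Fin.elim0) := Term.red_eq_numeral (computes_iff_noSkol.1 h)

theorem computes_of_red_eq {S : Sub L} {t : Term L 0} {m : ℕ} (h : t.red S = numeral m) :
    S.Computes t := by simp [Sub.Computes, h]

theorem computes_succ {S : Sub L} {t : Term L 0} : S.Computes (.succ t) ↔ S.Computes t := by
  simp [computes_iff_noSkol, Term.red, Term.NoSkol]

theorem computes_func {S : Sub L} {k : ℕ} {f : L.Functions k} {ts : Fin k → Term L 0} :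
    S.Computes (.func f ts) ↔ ∀ i, S.Computes (ts i) := by
  refine ⟨fun h i => ?_, fun h =>
    computes_of_red_eq (Term.red_func_of_numeral fun i => (h i).red_eq)⟩
  rcases Term.red_func_cases S f ts with ⟨v, hv⟩ | h'
  · exact computes_of_red_eq (hv i)
  · rw [computes_iff_noSkol, h'] at h
    exact computes_iff_noSkol.2 (h i)

theorem computes_skol {S : Sub L} {k : ℕ} {φ : Formula L (k + 1)} {ts : Fin k → Term L 0} :
    S.Computes (.skol φ ts) ↔ (∀ i, S.Computes (ts i)) ∧
      .term φ (fun i => (ts i).eval S Fin.elim0) ∈ S.dom := by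
  refine ⟨fun h => ?_, fun ⟨h, hd⟩ =>
    computes_of_red_eq (Term.red_skol_of_mem_dom (fun i => (h i).red_eq) hd)⟩
  rcases Term.red_skol_cases S φ ts with ⟨v, hv, hd⟩ | h'
  · have hc i : S.Computes (ts i) := computes_of_red_eq (hv i)
    obtain rfl : v = fun i => (ts i).eval S Fin.elim0 := funext fun i => by
      simpa using congrArg Term.num? ((hv i).symm.trans (hc i).red_eq)
    exact ⟨hc, hd⟩
  · rw [computes_iff_noSkol, h'] at h
    exact h.elim

theorem decides_iff_isArith {S : Sub L} {φ : Formula L 0} :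
    S.Decides φ ↔ (φ.red S).IsArith := by
  simp only [Sub.Decides, Sub.Sat, Formula.red, Formula.IsArith, Formula.NoSkol, Formula.HasI,
    Formula.Holds, Formula.Realize]
  tauto

theorem decides_top (S : Sub L) : S.Decides .top :=
  decides_iff_isArith.2 ⟨trivial, by simp [Formula.red, Formula.HasI]⟩

theorem decides_bot (S : Sub L) : S.Decides .bot :=
  decides_iff_isArith.2 ⟨trivial, by simp [Formula.red, Formula.HasI]⟩

theorem decides_neg {S : Sub L} {φ : Formula L 0} : S.Decides φ.neg ↔ S.Decides φ := by
  simp [decides_iff_isArith, Formula.IsArith, Formula.red, Formula.HasI, Formula.NoSkol]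

theorem decides_and {S : Sub L} {φ ψ : Formula L 0} :
    S.Decides (φ.and ψ) ↔ S.Decides φ ∧ S.Decides ψ := by
  simp only [decides_iff_isArith, Formula.IsArith, Formula.red, Formula.HasI, Formula.NoSkol]
  tauto

theorem decides_or {S : Sub L} {φ ψ : Formula L 0} :
    S.Decides (φ.or ψ) ↔ S.Decides φ ∧ S.Decides ψ := by
  simp only [decides_iff_isArith, Formula.IsArith, Formula.red, Formula.HasI, Formula.NoSkol]
  tauto

theorem decides_imp {S : Sub L} {φ ψ : Formula L 0} :
    S.Decides (φ.imp ψ) ↔ S.Decides φ ∧ S.Decides ψ := by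
  rw [Formula.imp, decides_or, decides_neg]

theorem decides_eq {S : Sub L} {s t : Term L 0} :
    S.Decides (.eq s t) ↔ S.Computes s ∧ S.Computes t := by
  rw [decides_iff_isArith, computes_iff_noSkol, computes_iff_noSkol]
  refine ⟨And.left, fun h => ⟨h, ?_⟩⟩
  simp [Formula.red, Formula.HasI, Term.red_eq_numeral h.1, Term.red_eq_numeral h.2]

theorem decides_rel {S : Sub L} {k : ℕ} {R : L.Relations k} {ts : Fin k → Term L 0} :
    S.Decides (.rel R ts) ↔ ∀ i, S.Computes (ts i) := by
  simp_rw [decides_iff_isArith, computes_iff_noSkol]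
  refine ⟨And.left, fun h => ⟨h, ?_⟩⟩
  simp [Formula.red, Formula.HasI, fun i => Term.red_eq_numeral (h i)]

theorem decides_mem {S : Sub L} {t : Term L 0} :
    S.Decides (.mem t) ↔ S.Computes t ∧ .form (t.eval S Fin.elim0) ∈ S.dom := by
  rw [decides_iff_isArith]
  refine ⟨fun h => ?_, fun ⟨hc, hd⟩ => ?_⟩
  · have hc : S.Computes t := by
      by_contra hn
      rw [Sub.Computes, Option.not_isSome_iff_eq_none] at hn
      simp [Formula.IsArith, Formula.red, hn, Formula.HasI] at h
    refine ⟨hc, ?_⟩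
    by_contra hd
    have hd : S (.form (t.eval S Fin.elim0)) = none := by simpa [Sub.dom] using hd
    simp [Formula.IsArith, Formula.red_mem_of_numeral hc.red_eq, hd, Formula.HasI] at h
  · obtain ⟨u, hu⟩ := Option.isSome_iff_exists.1 hd
    rw [Formula.red_mem_of_numeral hc.red_eq, hu]
    cases u <;> exact ⟨trivial, by simp [Formula.HasI]⟩

theorem Sub.Decides.holds_iff {S : Sub L} {φ : Formula L 0} (h : S.Decides φ) :
    (φ.red S).Holds ↔ φ.TrueIn S Fin.elim0 := by
  unfold Formula.Holds
  induction φ with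
  | top | bot => rfl
  | eq s t =>
    obtain ⟨hs, ht⟩ := decides_eq.1 h
    simp [Formula.red, Formula.Realize, Formula.TrueIn, hs.red_eq, ht.red_eq]
  | rel k R ts =>
    simp [Formula.red, Formula.Realize, Formula.TrueIn, fun i => (decides_rel.1 h i).red_eq]
  | mem t =>
    obtain ⟨hc, hd⟩ := decides_mem.1 h
    obtain ⟨u, hu⟩ := Option.isSome_iff_exists.1 hd
    rw [Formula.red_mem_of_numeral hc.red_eq, Formula.TrueIn, hu]
    cases u <;> simp [Formula.Realize]
  | neg φ ih => exact not_congr (ih (decides_neg.1 h))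
  | and φ ψ ih ih' => exact and_congr (ih (decides_and.1 h).1) (ih' (decides_and.1 h).2)
  | or φ ψ ih ih' => exact or_congr (ih (decides_or.1 h).1) (ih' (decides_or.1 h).2)

theorem sat_iff {S : Sub L} {φ : Formula L 0} :
    S.Sat φ ↔ S.Decides φ ∧ φ.TrueIn S Fin.elim0 := by
  rw [Sub.Sat, ← decides_iff_isArith]
  exact and_congr_right Sub.Decides.holds_iff

theorem Term.Occ.computes_of_subst {n : ℕ} {S : Sub L} {σ : Fin n → Term L 0} {j : Fin n}
    {t : Term L n} (hj : t.Occ j) (h : S.Computes (t.subst σ)) : S.Computes (σ j) := by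
  induction t with
  | var i => cases hj; exact h
  | zero => exact hj.elim
  | succ t ih => exact ih hj (computes_succ.1 h)
  | func k f ts ih =>
    obtain ⟨i, hi⟩ := hj
    exact ih i hi (computes_func.1 h i)
  | skol k φ ts ih =>
    obtain ⟨i, hi⟩ := hj
    exact ih i hi ((computes_skol.1 h).1 i)

theorem Formula.Occ.computes_of_decides {n : ℕ} {S : Sub L} {σ : Fin n → Term L 0} {j : Fin n}
    {φ : Formula L n} (hj : φ.Occ j) (h : S.Decides (φ.subst σ)) : S.Computes (σ j) := by
  induction φ with
  | top | bot => exact hj.elim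
  | eq s t =>
    exact hj.elim (·.computes_of_subst (decides_eq.1 h).1) (·.computes_of_subst (decides_eq.1 h).2)
  | rel k R ts =>
    obtain ⟨i, hi⟩ := hj
    exact hi.computes_of_subst (decides_rel.1 h i)
  | mem t => exact Term.Occ.computes_of_subst hj (decides_mem.1 h).1
  | neg φ ih => exact ih hj (decides_neg.1 h)
  | and φ ψ ih ih' => exact hj.elim (ih · (decides_and.1 h).1) (ih' · (decides_and.1 h).2)
  | or φ ψ ih ih' => exact hj.elim (ih · (decides_or.1 h).1) (ih' · (decides_or.1 h).2)

theorem Term.rkS_le_red_empty (t : Term L 0) : t.rkS ≤ (t.red fun _ => none).rkS := by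
  induction t with
  | var i => exact i.elim0
  | zero => rfl
  | succ t ih => simpa only [Term.red, Term.rkS] using ih
  | func k f ts ih =>
    rcases Term.red_func_cases (fun _ => none) f ts with ⟨v, hv⟩ | h
    · simp_all [Term.rkS]
    · simpa only [h, Term.rkS] using Finset.sup_mono_fun fun i _ => ih i
  | skol k φ ts ih =>
    rcases Term.red_skol_cases (fun _ => none) φ ts with ⟨v, -, hd⟩ | h
    · simp [Sub.dom] at hd
    · simpa only [h, Term.rkS] using max_le_max le_rfl (Finset.sup_mono_fun fun i _ => ih i)

theorem Formula.rkS_le_red_empty (φ : Formula L 0) : φ.rkS ≤ (φ.red fun _ => none).rkS := by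
  induction φ with
  | top | bot => rfl
  | eq s t =>
    simpa only [Formula.red, Formula.rkS] using
      max_le_max s.rkS_le_red_empty t.rkS_le_red_empty
  | rel k R ts =>
    simpa only [Formula.red, Formula.rkS] using
      Finset.sup_mono_fun fun i _ => (ts i).rkS_le_red_empty
  | mem t =>
    have : (Formula.mem t).red (fun _ => none) = .mem (t.red fun _ => none) := by
      simp only [Formula.red]
      split <;> rfl
    simpa only [this, Formula.rkS] using t.rkS_le_red_empty
  | neg φ ih => simpa only [Formula.red, Formula.rkS] using ih
  | and φ ψ ih ih' => simpa only [Formula.red, Formula.rkS] using max_le_max ih ih'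
  | or φ ψ ih ih' => simpa only [Formula.red, Formula.rkS] using max_le_max ih ih'

theorem Sub.Computes.mono_and_eval_eq {S T : Sub L} (h : S.Le T) {t : Term L 0}
    (ht : S.Computes t) : T.Computes t ∧ t.eval T Fin.elim0 = t.eval S Fin.elim0 := by
  induction t with
  | var i => exact i.elim0
  | zero => exact ⟨rfl, rfl⟩
  | succ t ih =>
    have := ih (computes_succ.1 ht)
    exact ⟨computes_succ.2 this.1, congrArg (· + 1) this.2⟩
  | func k f ts ih =>
    have := fun i => ih i (computes_func.1 ht i)
    exact ⟨computes_func.2 fun i => (this i).1, by simp [Term.eval, fun i => (this i).2]⟩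
  | skol k φ ts ih =>
    obtain ⟨hc, hd⟩ := computes_skol.1 ht
    have ih := fun i => ih i (hc i)
    obtain ⟨u, hu⟩ := Option.isSome_iff_exists.1 hd
    have he : (fun i => (ts i).eval T Fin.elim0) = fun i => (ts i).eval S Fin.elim0 :=
      funext fun i => (ih i).2
    exact ⟨computes_skol.2 ⟨fun i => (ih i).1, he ▸ h.mem_dom hd⟩,
      by simp only [Term.eval, he, hu, h _ _ hu]⟩

theorem Sub.Computes.mono {S T : Sub L} (h : S.Le T) {t : Term L 0} (ht : S.Computes t) :
    T.Computes t := (ht.mono_and_eval_eq h).1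

theorem Sub.Computes.eval_eq {S T : Sub L} (h : S.Le T) {t : Term L 0} (ht : S.Computes t) :
    t.eval T Fin.elim0 = t.eval S Fin.elim0 := (ht.mono_and_eval_eq h).2

theorem Sub.Decides.mono {S T : Sub L} (h : S.Le T) {φ : Formula L 0} (hφ : S.Decides φ) :
    T.Decides φ := by
  induction φ with
  | top => exact decides_top T
  | bot => exact decides_bot T
  | eq s t => exact decides_eq.2 ((decides_eq.1 hφ).imp (·.mono h) (·.mono h))
  | rel k R ts => exact decides_rel.2 fun i => (decides_rel.1 hφ i).mono h
  | mem t =>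
    obtain ⟨hc, hd⟩ := decides_mem.1 hφ
    exact decides_mem.2 ⟨hc.mono h, hc.eval_eq h ▸ h.mem_dom hd⟩
  | neg φ ih => exact decides_neg.2 (ih (decides_neg.1 hφ))
  | and φ ψ ih ih' => exact decides_and.2 ((decides_and.1 hφ).imp ih ih')
  | or φ ψ ih ih' => exact decides_or.2 ((decides_or.1 hφ).imp ih ih')

@[simp] theorem Term.eval_bar {n : ℕ} (S : Sub L) (x : Fin n → ℕ) (t : Term L n) :
    t.eval S.bar x = t.eval S x := by
  induction t with
  | var | zero => rfl
  | succ t ih => exact congrArg (· + 1) ih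
  | func k f ts ih => simp only [Term.eval, ih]
  | skol k φ ts ih =>
    simp only [Term.eval, ih]
    rcases hS : S (.term φ fun i => (ts i).eval S x) with _ | u
    · by_cases hc : CanExpr.IsCanonical (.term φ fun i => (ts i).eval S x) <;>
        simp [Sub.bar, hS, hc]
    · simp [Sub.bar, hS]

@[simp] theorem Formula.trueIn_bar {n : ℕ} (S : Sub L) (x : Fin n → ℕ) (φ : Formula L n) :
    φ.TrueIn S.bar x ↔ φ.TrueIn S x := by
  induction φ with
  | mem t => simp [Formula.TrueIn, bar_eq_some_iff]
  | _ => simp_all [Formula.TrueIn]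

theorem Term.WF.computes_bar {S : Sub L} {t : Term L 0} (ht : t.WF) : S.bar.Computes t := by
  induction t with
  | var i => exact i.elim0
  | zero => rfl
  | succ t ih => simp_all [Term.WF, computes_succ]
  | func k f ts ih => simp_all [Term.WF, computes_func]
  | skol k φ ts ih =>
    simp only [Term.WF] at ht
    exact computes_skol.2 ⟨fun i => ih i (ht.2 i), mem_dom_bar ht.1⟩

theorem Formula.WF.decides_bar {S : Sub L} {φ : Formula L 0} (hφ : φ.WF) : S.bar.Decides φ := by
  induction φ with
  | mem t =>
    simp only [Formula.WF] at hφ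
    exact decides_mem.2 ⟨hφ.computes_bar, mem_dom_bar trivial⟩
  | _ => simp_all [Formula.WF, Term.WF.computes_bar, decides_top, decides_bot, decides_eq,
      decides_rel, decides_neg, decides_and, decides_or]

theorem Formula.WF.sat_bar_iff {S : Sub L} {φ : Formula L 0} (hφ : φ.WF) :
    S.bar.Sat φ ↔ φ.TrueIn S Fin.elim0 := by
  rw [sat_iff, Formula.trueIn_bar]
  exact and_iff_right hφ.decides_bar

theorem Term.WF.ev_eq {S : Sub L} {t : Term L 0} (ht : t.WF) :
    S.ev t = t.eval S Fin.elim0 := by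
  rw [Sub.ev, (ht.computes_bar (S := S)).red_eq, num?_numeral, Term.eval_bar, Option.getD_some]

end Semantics

/-! ### Critical formulas and ranks -/

/-- `φ` is a matrix: a formula from which a Skolem function may be formed. -/
abbrev Formula.IsMatrix {n : ℕ} (φ : Formula L n) : Prop := φ.Simple ∧ φ.WF

section Matrices

variable {k n r : ℕ} {φ : Formula L (k + 1)} {s : Fin k → Term L n} {t : Term L n}

theorem Formula.IsMatrix.neg {φ : Formula L n} (h : φ.IsMatrix) : φ.neg.IsMatrix := by
  simpa only [Formula.IsMatrix, Formula.Simple, Formula.WF] using h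

theorem Formula.WF.neg {φ : Formula L n} (h : φ.WF) : φ.neg.WF := by
  simpa only [Formula.WF]

theorem Formula.WF.imp {φ ψ : Formula L n} (h : φ.WF) (h' : ψ.WF) : (φ.imp ψ).WF := by
  simp [Formula.imp, Formula.WF, h, h']

theorem Formula.IsMatrix.imp {φ ψ : Formula L n} (h : φ.IsMatrix) (h' : ψ.IsMatrix) :
    (φ.imp ψ).IsMatrix :=
  ⟨⟨h.1, h'.1⟩, h.2.imp h'.2⟩

theorem Formula.WF.inst (hφ : φ.WF) (hs : ∀ i, (s i).WF) (ht : t.WF) : (inst φ s t).WF :=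
  hφ.subst <| Fin.cases ht hs

theorem Formula.IsMatrix.skol_wf (h : φ.IsMatrix) (hs : ∀ i, (s i).WF) :
    (Term.skol φ s).WF := by
  simpa only [Term.WF] using ⟨h, hs⟩

theorem Formula.IsMatrix.exF_wf (h : φ.IsMatrix) (hs : ∀ i, (s i).WF) : (exF φ s).WF :=
  h.2.inst hs (h.skol_wf hs)

theorem Formula.IsMatrix.allF_wf (h : φ.IsMatrix) (hs : ∀ i, (s i).WF) : (allF φ s).WF :=
  h.2.inst hs (h.neg.skol_wf hs)

theorem predMatrix_isMatrix : (predMatrix : Formula L 2).IsMatrix :=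
  ⟨⟨trivial, trivial⟩, by simp [predMatrix, Formula.WF, Term.WF]⟩

theorem Formula.IsMatrix.indStep (h : φ.IsMatrix) : (indStep φ).IsMatrix := by
  refine ⟨⟨h.1, h.1.subst <| Fin.cases trivial fun _ => trivial⟩, ?_⟩
  simp only [EpsID1.indStep, Formula.WF]
  exact ⟨h.2, h.2.subst <| Fin.cases (by simp [Term.WF]) fun _ => by simp [Term.WF]⟩

theorem isMatrix_mem_var (i : Fin n) : (Formula.mem (.var i) : Formula L n).IsMatrix :=
  ⟨trivial, by simp [Formula.WF, Term.WF]⟩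

theorem rkS_imp (φ ψ : Formula L n) : (φ.imp ψ).rkS = max φ.rkS ψ.rkS := by
  simp [Formula.imp, Formula.rkS]

theorem rkS_inst_le (hφ : φ.rkS ≤ r) (hs : ∀ i, (s i).rkS ≤ r) (ht : t.rkS ≤ r) :
    (inst φ s t).rkS ≤ r :=
  Formula.rkS_subst_le (Fin.cases ht hs) hφ

theorem Formula.Occ.rkS_lt_of_inst_skol {ψ : Formula L (k + 1)} (hφ : φ.Occ 0)
    (h : (EpsID1.inst φ s (.skol ψ s)).rkS ≤ r) : ψ.rkS < r ∧ ∀ i, (s i).rkS ≤ r := by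
  have := (hφ.rkS_le_subst (σ := Fin.cons (.skol ψ s) s)).trans h
  simpa [Term.rkS, Nat.succ_le_iff] using this

theorem conjNeg_wf {φ : ℕ → Formula L 0} (h : ∀ u, (φ u).WF) (u : ℕ) : (conjNeg φ u).WF := by
  induction u <;> simp_all [conjNeg, Formula.WF]

theorem rkS_conjNeg_le {φ : ℕ → Formula L 0} (h : ∀ u, (φ u).rkS ≤ r) (u : ℕ) :
    (conjNeg φ u).rkS ≤ r := by
  induction u <;> simp_all [conjNeg, Formula.rkS]

end Matrices

theorem Om_le_Om_add_add_one (r : ℕ) : Om ≤ Om + (r : Ordinal.{0}) + 1 :=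
  le_self_add.trans le_self_add

namespace PosOp

variable (D : PosOp L) {k n r : ℕ} {φ : Formula L (k + 1)} {s : Fin k → Term L n} {t : Term L n}

theorem B_isMatrix : D.B.IsMatrix := ⟨D.simple, D.noSkol.wf⟩

theorem A_wf (ht : t.WF) : (D.A t).WF := D.B_isMatrix.allF_wf fun _ => ht

theorem Bφ_isMatrix (h : φ.IsMatrix) : (D.Bφ φ).IsMatrix := by
  have var_wf (i : Fin (k + 2)) : (Term.var i : Term L (k + 2)).WF := by simp [Term.WF]
  have var_simple (i : Fin (k + 2)) : (Term.var i : Term L (k + 2)).Simple := trivial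
  exact ⟨(D.simple.subst fun _ => var_simple _).plug fun _ ht =>
      h.1.subst <| Fin.cases ht fun _ => var_simple _,
    (D.noSkol.wf.subst fun _ => var_wf _).plug fun _ ht =>
      h.2.subst <| Fin.cases ht fun _ => var_wf _⟩

theorem Aφ_wf (h : φ.IsMatrix) (hs : ∀ i, (s i).WF) (ht : t.WF) : (D.Aφ φ s t).WF :=
  (D.Bφ_isMatrix h).allF_wf <| Fin.cases ht hs

theorem prog_isMatrix (h : φ.IsMatrix) : (D.prog φ).IsMatrix := by
  have var_wf (i : Fin (k + 1)) : (Term.var i : Term L (k + 1)).WF := by simp [Term.WF]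
  refine .imp ⟨?_, D.Aφ_wf h (fun _ => var_wf _) (var_wf _)⟩ h
  have vars_simple (i : Fin (k + 1)) : ((Fin.cons (.var 0) fun i => .var i.succ :
      Fin (k + 1) → Term L (k + 1)) i).Simple := Fin.cases trivial (fun _ => trivial) i
  exact (D.Bφ_isMatrix h).1.subst <| Fin.cases ⟨fun hc => hc 0, vars_simple⟩ vars_simple

theorem rkS_Bφ_le (φ : Formula L (k + 1)) : (D.Bφ φ).rkS ≤ φ.rkS := by
  have var_noSkol (i : Fin (k + 2)) : (Term.var i : Term L (k + 2)).NoSkol := trivial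
  refine (D.noSkol.subst fun _ => var_noSkol _).rkS_plug_le fun t ht =>
    Formula.rkS_subst_le ?_ le_rfl
  exact Fin.cases (ht.rkS_eq_zero.trans_le (Nat.zero_le _)) fun _ => by simp [Term.rkS]

theorem rkS_Aφ_le (h : φ.rkS < r) (hs : ∀ i, (s i).rkS ≤ r) (ht : t.rkS ≤ r) :
    (D.Aφ φ s t).rkS ≤ r := by
  have hB : (D.Bφ φ).rkS < r := (D.rkS_Bφ_le φ).trans_lt h
  have hts (i : Fin (k + 1)) : ((Fin.cons t s : Fin (k + 1) → Term L n) i).rkS ≤ r :=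
    Fin.cases ht hs i
  refine Formula.rkS_subst_le (Fin.cases ?_ hts) hB.le
  simpa [Term.rkS, Formula.rkS] using ⟨hB, hts⟩

theorem F_wf {e : CanExpr L} (he : e.IsCanonical) : ∀ u, (D.F e u).WF := by
  rintro (_ | u | _) <;> rcases e with ⟨φ, v⟩ | n <;> simp only [F, Formula.WF]
  · have hφ (u : ℕ) : (instNum φ v u).WF := he.2.inst (by simp) (by simp)
    exact ⟨hφ u, conjNeg_wf hφ u⟩
  · exact D.A_wf (numeral_wf n)

theorem rkS_F_le (φ : Formula L (k + 1)) (v : Fin k → ℕ) : ∀ u, (D.F (.term φ v) u).rkS ≤ φ.rkS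
  | .unk | .tt => Nat.zero_le _
  | .num u => by
    have hφ (u : ℕ) : (instNum φ v u).rkS ≤ φ.rkS := rkS_inst_le le_rfl (by simp) (by simp)
    simpa only [F, Formula.rkS, max_le_iff] using ⟨hφ u, rkS_conjNeg_le hφ u⟩

@[simp] theorem rk_form (n : ℕ) : D.rk (.form n) = Om := rfl

@[simp] theorem rk_c (n : ℕ) : D.rk (D.c n) = Om := if_pos ⟨n, rfl⟩

@[simp] theorem c_inj {m n : ℕ} : D.c m = D.c n ↔ m = n := by
  simp [c, funext_iff]

@[simp] theorem form_ne_c (m n : ℕ) : .form m ≠ D.c n := nofun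

theorem rk_term_le (v : Fin k → ℕ) (h : φ.rkS < r) :
    D.rk (.term φ v) ≤ Om + (r : Ordinal.{0}) + 1 := by
  have finite_lt_Om : ((φ.rkS + 1 : ℕ) : Ordinal.{0}) < Om :=
    (Ordinal.natCast_lt_omega0 _).trans Ordinal.omega0_lt_omega_one
  rw [PosOp.rk]
  split_ifs
  · exact Om_le_Om_add_add_one r
  · have : ((φ.rkS + 1 : ℕ) : Ordinal.{0}) ≤ (r : Ordinal.{0}) := by exact_mod_cast h
    gcongr
  · exact finite_lt_Om.le.trans (Om_le_Om_add_add_one r)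

end PosOp

theorem Critical.WF.toFormula (D : PosOp L) {c : Critical L} (h : c.WF) : (c.toFormula D).WF := by
  match c, h with
  | .pred s, (hs : s.WF) =>
    exact .imp (by simpa only [Formula.WF, Term.WF, and_true])
      (predMatrix_isMatrix.exF_wf fun _ => hs)
  | .eps φ s t, ⟨(hφ : φ.IsMatrix), hs, ht⟩ => exact (hφ.2.inst hs ht).imp (hφ.exF_wf hs)
  | .ind φ s t, ⟨(hφ : φ.IsMatrix), hs, ht⟩ =>
    refine .imp ?_ (hφ.indStep.exF_wf hs)
    simpa only [Formula.WF] using ⟨hφ.2.inst hs (by simp [Term.WF]), hφ.2.inst hs ht⟩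
  | .inddef t, (ht : t.WF) => exact (D.A_wf ht).imp (by simpa only [Formula.WF])
  | .closure φ s, ⟨(hφ : φ.IsMatrix), hs⟩ =>
    exact ((D.prog_isMatrix hφ).allF_wf hs).imp (((isMatrix_mem_var 0).imp hφ).allF_wf hs)

/-! ### Forcing along `Cut` inferences -/

theorem PosOp.IsHistory.append {D : PosOp L} {P P' : List ℕ}
    {V V' : ℕ → Option (Sub L)} (h : D.IsHistory P V) (h' : D.IsHistory P' V')
    (hP : ∀ m ∈ P', m ∉ P) :
    D.IsHistory (P ++ P') fun m => if m ∈ P' then V' m else V m := by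
  refine ⟨List.nodup_append.2 ⟨h.1, h'.1, ?_⟩, fun m => ?_,
    fun m T (hT : (if m ∈ P' then V' m else V m) = some T) => ?_⟩
  · rintro m hm _ hm' rfl
    exact hP m hm' hm
  · by_cases hm : m ∈ P' <;> simp [hm, h.2.1, h'.2.1]
  · split_ifs at hT with hm
    · exact h'.2.2 m T hT
    · exact h.2.2 m T hT

section Forcing

variable [L.Structure ℕ]

/-- `Θ` has a derivation by `Cut`-inferences of rank at most `Ω + r + 1`. -/
def CutDerivable (D : PosOp L) {N : ℕ} (Cr : Fin (N + 1) → Critical L) (r : ℕ) (Θ : Sequent L) :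
    Prop :=
  ∃ d : Derivation D Cr Θ, d.AllRules (D.IsCutLE (Om + (r : Ordinal.{0}) + 1))

/-- An invariant of all sequents met in a derivation of `∅` by `Cut`-inferences, read upwards. -/
structure Reachable (D : PosOp L) (Θ : Sequent L) : Prop where
  isSequent : D.IsSequent Θ
  label_eq_false : ∀ e b, Θ.F e = some b → b = false
  admissible : D.Admissible Θ.P

/-- `Ψ` extends `Θ` without leaving new debts: it decides `F(e, u)` for every new value `u` of a
term `e`, and has `n ∈ I` in its domain whenever `c_n` is new. -/
structure SaturatedExt (D : PosOp L) (Θ Ψ : Sequent L) : Prop where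
  le : Θ.S.Le Ψ.S
  isPrefix : Θ.P <+: Ψ.P
  decides_F : ∀ e u, Ψ.S e = some u → Θ.S e = none → e.IsTerm → Ψ.S.Decides (D.F e u)
  form_mem_dom : ∀ n, D.c n ∈ Ψ.S.dom → D.c n ∉ Θ.S.dom → .form n ∈ Ψ.S.dom

/-- `Θ` is derivable as soon as all its saturated extensions with the property `Q` are: by `Cut`s,
`Q` can be assumed. -/
def Forces (D : PosOp L) {N : ℕ} (Cr : Fin (N + 1) → Critical L) (r : ℕ) (Θ : Sequent L)
    (Q : Sequent L → Prop) : Prop :=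
  (∀ Ψ, SaturatedExt D Θ Ψ → Reachable D Ψ → Q Ψ → CutDerivable D Cr r Ψ) → CutDerivable D Cr r Θ

/-- Every reachable sequent forces `Q`. -/
def Forceable (D : PosOp L) {N : ℕ} (Cr : Fin (N + 1) → Critical L) (r : ℕ)
    (Q : Sequent L → Prop) : Prop :=
  ∀ Θ, Reachable D Θ → Forces D Cr r Θ Q

/-- `Q` is inherited by saturated extensions. -/
def Persistent (D : PosOp L) (Q : Sequent L → Prop) : Prop :=
  ∀ Θ Ψ, SaturatedExt D Θ Ψ → Q Θ → Q Ψ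

variable {D : PosOp L} {N r : ℕ} {Cr : Fin (N + 1) → Critical L} {Θ Ψ Ξ : Sequent L}
  {Q R : Sequent L → Prop}

theorem CutDerivable.inf (hΘ : D.IsSequent Θ) {ρ : Rule L}
    (hρ : D.IsCutLE (Om + (r : Ordinal.{0}) + 1) ρ) (h : D.Applicable Cr Θ ρ)
    (hp : ∀ Ψ, D.IsPremise Θ Ψ ρ → CutDerivable D Cr r Ψ) : CutDerivable D Cr r Θ := by
  choose d hd using hp
  exact ⟨.inf Θ hΘ ρ h d, hρ, hd⟩

theorem SaturatedExt.refl (D : PosOp L) (Θ : Sequent L) : SaturatedExt D Θ Θ where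
  le _ _ h := h
  isPrefix := List.prefix_rfl
  decides_F e u h h' := by simp [h] at h'
  form_mem_dom n h h' := (h' h).elim

theorem SaturatedExt.trans (h : SaturatedExt D Θ Ψ) (h' : SaturatedExt D Ψ Ξ) :
    SaturatedExt D Θ Ξ where
  le e u he := h'.le e u (h.le e u he)
  isPrefix := h.isPrefix.trans h'.isPrefix
  decides_F e u he hn ht := by
    rcases hΨ : Ψ.S e with _ | w
    · exact h'.decides_F e u he hΨ ht
    · obtain rfl : w = u := Option.some.inj ((h'.le e w hΨ).symm.trans he)
      exact (h.decides_F e w hΨ hn ht).mono h'.le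
  form_mem_dom n hn hn' := by
    by_cases hd : D.c n ∈ Ψ.S.dom
    · exact h'.le.mem_dom (h.form_mem_dom n hd hn')
    · exact h'.form_mem_dom n hn hd

open Classical in
theorem SaturatedExt.of_update {e : CanExpr L} {u : Val}
    (hS : Ψ.S = Function.update Θ.S e (some u)) (hP : Ψ.P = Θ.P) (he : e ∉ Θ.S.dom)
    (h : SaturatedExt D Ψ Ξ) (hF : e.IsTerm → Ξ.S.Decides (D.F e u))
    (hform : ∀ n, e = D.c n → .form n ∈ Ξ.S.dom) : SaturatedExt D Θ Ξ where
  le e' w hw := by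
    have hne : e' ≠ e := by rintro rfl; exact he (by simp [Sub.dom, hw])
    exact h.le e' w (by simp [hS, hne, hw])
  isPrefix := hP ▸ h.isPrefix
  decides_F e' w hw hn ht := by
    by_cases hee : e' = e
    · subst hee
      obtain rfl : u = w := Option.some.inj ((h.le e' u (by simp [hS])).symm.trans hw)
      exact hF ht
    · exact h.decides_F e' w hw (by simp [hS, hee, hn]) ht
  form_mem_dom n hn hn' := by
    by_cases hee : D.c n = e
    · exact hform n hee.symm
    · exact h.form_mem_dom n hn (by simpa [Sub.dom, hS, hee] using hn')

theorem SaturatedExt.addTop {n : ℕ} {Pe : List ℕ} (hp : D.Proper n Θ Pe) (b : Bool)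
    (Ve : ℕ → Option (Sub L)) : SaturatedExt D Θ (Θ.addTop b Pe Ve) where
  le e u he := by
    obtain ⟨-, -, -, -, -, hdom⟩ := hp
    have : ¬ ∃ m ∈ Pe, e = .form m := by
      rintro ⟨m, hm, rfl⟩
      exact hdom m hm (by simp [Sub.dom, he])
    simpa only [Sequent.addTop, if_neg this]
  isPrefix := List.prefix_append _ _
  decides_F e u he hn ht := by
    cases e with
    | form m => exact ht.elim
    | term φ v => simp [Sequent.addTop, hn] at he
  form_mem_dom m hm hm' := (hm' (by simpa [Sequent.addTop, Sub.dom, PosOp.c] using hm)).elim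

theorem Forces.bind (h : Forces D Cr r Θ Q)
    (h' : ∀ Ψ, SaturatedExt D Θ Ψ → Reachable D Ψ → Q Ψ → Forces D Cr r Ψ R) :
    Forces D Cr r Θ R :=
  fun hR => h fun Ψ hΨ hr hQ => h' Ψ hΨ hr hQ fun Ξ hΞ => hR Ξ (hΨ.trans hΞ)

theorem Forces.imp (h : Forces D Cr r Θ Q)
    (hi : ∀ Ψ, SaturatedExt D Θ Ψ → Q Ψ → R Ψ) : Forces D Cr r Θ R :=
  fun hR => h fun Ψ hΨ hr hQ => hR Ψ hΨ hr (hi Ψ hΨ hQ)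

theorem Forces.of_holds (hr : Reachable D Θ) (h : Q Θ) : Forces D Cr r Θ Q :=
  fun hQ => hQ Θ (.refl D Θ) hr h

theorem Forceable.of_forall (h : ∀ Θ, Q Θ) : Forceable D Cr r Q :=
  fun Θ hr => .of_holds hr (h Θ)

theorem Forceable.imp (h : Forceable D Cr r Q) (hi : ∀ Θ, Q Θ → R Θ) : Forceable D Cr r R :=
  fun Θ hr => (h Θ hr).imp fun Ψ _ => hi Ψ

theorem Forceable.and (hQ : Forceable D Cr r Q) (hp : Persistent D Q) (hR : Forceable D Cr r R) :
    Forceable D Cr r fun Θ => Q Θ ∧ R Θ :=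
  fun Θ hr => (hQ Θ hr).bind fun Ψ _ hr' hq => (hR Ψ hr').imp fun _ hΞ hR => ⟨hp _ _ hΞ hq, hR⟩

theorem Forceable.forall_mem {α : Type*} {Q : α → Sequent L → Prop} (l : List α)
    (hQ : ∀ a ∈ l, Forceable D Cr r (Q a)) (hp : ∀ a, Persistent D (Q a)) :
    Forceable D Cr r fun Θ => ∀ a ∈ l, Q a Θ := by
  induction l with
  | nil => exact .of_forall fun Θ => by simp
  | cons a l ih =>
    exact ((hQ a (by simp)).and (hp a) (ih fun b hb => hQ b (by simp [hb]))).imp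
      fun _ h => by simpa using h

theorem Forceable.forall_fin {k : ℕ} {Q : Fin k → Sequent L → Prop}
    (hQ : ∀ i, Forceable D Cr r (Q i)) (hp : ∀ i, Persistent D (Q i)) :
    Forceable D Cr r fun Θ => ∀ i, Q i Θ :=
  (Forceable.forall_mem (List.finRange k) (fun i _ => hQ i) hp).imp fun _ h i =>
    h i (List.mem_finRange i)

theorem persistent_decides (φ : Formula L 0) : Persistent D fun Θ => Θ.S.Decides φ :=
  fun _ _ h hφ => hφ.mono h.le

theorem persistent_computes (t : Term L 0) : Persistent D fun Θ => Θ.S.Computes t :=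
  fun _ _ h ht => ht.mono h.le

theorem persistent_mem_dom (e : CanExpr L) : Persistent D fun Θ => e ∈ Θ.S.dom :=
  fun _ _ h he => h.le.mem_dom he

open Classical in
theorem Reachable.of_update (h : Reachable D Θ) {e : CanExpr L} {u : Val} (he : e ∉ Θ.S.dom)
    (hc : e.IsCanonical) (hu : e.Fits u) (htt : u ≠ .tt) {F : CanExpr L → Option Bool}
    (hF : ∀ e' ≠ e, F e' = Θ.F e') (hfalse : ∀ b, F e = some b → b = false)
    (hlabel : (F e).isSome ↔ u = .unk ∨ D.rk e = Om) :
    Reachable D ⟨Function.update Θ.S e (some u), Θ.P, Θ.V, F⟩ := by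
  obtain ⟨⟨isSub, isHistory, mem_P, labelled⟩, label_eq_false, admissible⟩ := h
  refine ⟨⟨fun e' w hw => ?_, isHistory, fun n => ?_, fun e' => ?_⟩, fun e' b hb => ?_, admissible⟩
  · by_cases hee : e' = e
    · subst hee
      obtain rfl : u = w := by simpa using hw
      exact ⟨hc, hu⟩
    · exact isSub e' w (by simpa [hee] using hw)
  · by_cases hee : CanExpr.form n = e
    · subst hee
      have : Θ.S (.form n) = none := by simpa [Sub.dom] using he
      simp [mem_P, this, htt]
    · simp [hee, mem_P]
  · by_cases hee : e' = e
    · subst hee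
      simpa [PosOp.Labelled, Sub.dom] using hlabel
    · simpa [PosOp.Labelled, Sub.dom, hee, hF e' hee] using labelled e'
  · by_cases hee : e' = e
    · exact hfalse b (hee ▸ hb)
    · exact label_eq_false e' b (hF e' hee ▸ hb)

theorem Reachable.addL (h : Reachable D Θ) {e : CanExpr L} {u : Val} (he : e ∉ Θ.S.dom)
    (hc : e.IsCanonical) (hu : e.Fits u) (htt : u ≠ .tt) (hlabel : u = .unk ∨ D.rk e = Om) :
    Reachable D (Θ.addL e u false) :=
  h.of_update he hc hu htt (fun e' hee => by simp [hee]) (by simp) (by simpa using hlabel)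

theorem Reachable.add (h : Reachable D Θ) {e : CanExpr L} {m : ℕ} (he : e ∉ Θ.S.dom)
    (hc : e.IsCanonical) (hu : e.Fits (.num m)) (hrk : D.rk e ≠ Om) :
    Reachable D (Θ.add e (.num m)) := by
  have unlabelled : Θ.F e = none := by
    rw [← Option.not_isSome_iff_eq_none, h.isSequent.2.2.2]
    rintro (h' | h')
    · exact he (by simp [Sub.dom, h'])
    · exact he h'.1
  exact h.of_update he hc hu (by simp) (fun _ _ => rfl) (by simp [unlabelled])
    (by simp [unlabelled, hrk])

theorem Reachable.addTop (h : Reachable D Θ) {n : ℕ} {Pe : List ℕ} {Ve : ℕ → Option (Sub L)}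
    (hp : D.Proper n Θ Pe) (hV : D.IsHistory Pe Ve) : Reachable D (Θ.addTop false Pe Ve) := by
  obtain ⟨⟨isSub, isHistory, mem_P, labelled⟩, label_eq_false, -⟩ := h
  obtain ⟨-, -, admissible, -, notMem_P, -⟩ := hp
  refine ⟨⟨fun e w hw => ?_, isHistory.append hV notMem_P, fun m => ?_, fun e => ?_⟩,
    fun e b hb => ?_, admissible⟩
  · simp only [Sequent.addTop] at hw
    split_ifs at hw with he
    · obtain ⟨m, -, rfl⟩ := he
      cases hw
      exact ⟨trivial, trivial⟩
    · exact isSub e w hw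
  · by_cases hm : m ∈ Pe <;> simp [Sequent.addTop, hm, mem_P]
  · by_cases he : ∃ m ∈ Pe, e = .form m
    · obtain ⟨m, hm, rfl⟩ := he
      simp [Sequent.addTop, PosOp.Labelled, Sub.dom, hm]
    · simpa only [Sequent.addTop, PosOp.Labelled, Sub.dom, Set.mem_ofPred_eq, if_neg he]
        using labelled e
  · simp only [Sequent.addTop] at hb
    split_ifs at hb with he
    · exact (Option.some.inj hb).symm
    · exact label_eq_false e b hb

open Classical in
theorem CutDerivable.of_cut_term {k : ℕ} {φ : Formula L (k + 1)} {v : Fin k → ℕ}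
    (hr : Reachable D Θ) (hφ : φ.IsMatrix) (hrk : D.rk (.term φ v) ≤ Om + (r : Ordinal.{0}) + 1)
    (he : .term φ v ∉ Θ.S.dom)
    (h : ∀ Ψ u, Ψ.S = Function.update Θ.S (.term φ v) (some u) → Ψ.P = Θ.P → Reachable D Ψ →
      CutDerivable D Cr r Ψ) : CutDerivable D Cr r Θ := by
  have unk := h (Θ.addL (.term φ v) .unk false) .unk rfl rfl
    (hr.addL he hφ trivial (by simp) (.inl rfl))
  by_cases hOm : D.rk (.term φ v) = Om
  · refine .inf hr.isSequent (ρ := .cutOmTerm _) hrk ⟨hφ, trivial, hOm, he⟩ ?_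
    rintro Ψ (rfl | ⟨u, hu, rfl⟩)
    · exact unk
    · exact h _ (.num u) rfl rfl (hr.addL he hφ hu (by simp) (.inr hOm))
  · refine .inf hr.isSequent (ρ := .cut _) hrk ⟨hφ, trivial, hOm, he⟩ ?_
    rintro Ψ (rfl | ⟨u, hu, rfl⟩)
    · exact unk
    · exact h _ (.num u) rfl rfl (hr.add he hφ hu hOm)

theorem forceable_form (n : ℕ) : Forceable D Cr r fun Θ => .form n ∈ Θ.S.dom := by
  intro Θ hr
  by_cases hd : .form n ∈ Θ.S.dom
  · exact .of_holds hr hd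
  refine fun h => .inf hr.isSequent (ρ := .cutOmForm n) (Om_le_Om_add_add_one r) hd ?_
  rintro Ψ (rfl | ⟨Pe, Ve, hp, hV, rfl⟩)
  · refine h _ ?_ (hr.addL hd trivial trivial (by simp) (.inl rfl))
      (by simp [Sequent.addL, Sub.dom])
    exact .of_update (Ψ := Θ.addL (.form n) .unk false) rfl rfl hd (.refl D _) False.elim
      fun m hm => (D.form_ne_c n m hm).elim
  · have : n ∈ Pe := List.mem_of_getLast? hp.2.2.2.1
    exact h _ (.addTop hp false Ve) (hr.addTop hp hV) (by simp [Sequent.addTop, Sub.dom, this])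

theorem forceable_form_of_eq_c (e : CanExpr L) :
    Forceable D Cr r fun Θ => ∀ n, e = D.c n → .form n ∈ Θ.S.dom := by
  by_cases h : ∃ n, e = D.c n
  · obtain ⟨n, rfl⟩ := h
    exact (forceable_form n).imp fun Θ hn m hm => D.c_inj.1 hm ▸ hn
  · exact .of_forall fun Θ n hn => (h ⟨n, hn⟩).elim

theorem forceable_term {k : ℕ} {φ : Formula L (k + 1)} {v : Fin k → ℕ} (hφ : φ.IsMatrix)
    (hrk : D.rk (.term φ v) ≤ Om + (r : Ordinal.{0}) + 1)
    (hF : ∀ u, Forceable D Cr r fun Θ => Θ.S.Decides (D.F (.term φ v) u)) :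
    Forceable D Cr r fun Θ => .term φ v ∈ Θ.S.dom := by
  intro Θ hr
  by_cases hd : .term φ v ∈ Θ.S.dom
  · exact .of_holds hr hd
  refine fun h => .of_cut_term hr hφ hrk hd fun Ψ u hS hP hΨ => ?_
  refine ((hF u).and (persistent_decides _) (forceable_form_of_eq_c (.term φ v))) Ψ hΨ ?_
  rintro Ξ hΞ hr' ⟨hdec, hform⟩
  exact h Ξ (.of_update hS hP hd hΞ (fun _ => hdec) hform) hr'
    (hΞ.le.mem_dom (by simp [Sub.dom, hS]))

theorem forceable_computes_of_decides {q : ℕ} (hq : q ≤ r)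
    (hdec : ∀ φ : Formula L 0, φ.WF → φ.rkS < q → Forceable D Cr r fun Θ => Θ.S.Decides φ)
    {t : Term L 0} (hw : t.WF) (ht : t.rkS ≤ q) : Forceable D Cr r fun Θ => Θ.S.Computes t := by
  induction t with
  | var i => exact i.elim0
  | zero => exact .of_forall fun Θ => rfl
  | succ t iht =>
    simp only [Term.WF, Term.rkS] at hw ht
    exact (iht hw ht).imp fun Θ => computes_succ.2
  | func k f ts iht =>
    simp only [Term.WF, Term.rkS, Finset.sup_le_iff, Finset.mem_univ, true_imp_iff] at hw ht
    exact (Forceable.forall_fin (fun i => iht i (hw i) (ht i))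
      fun i => persistent_computes _).imp fun Θ => computes_func.2
  | skol k φ ts iht =>
    simp only [Term.WF, Term.rkS, max_le_iff, Finset.sup_le_iff, Finset.mem_univ,
      true_imp_iff] at hw ht
    intro Θ hr
    refine (Forceable.forall_fin (fun i => iht i (hw.2 i) (ht.2 i))
      (fun i => persistent_computes _) Θ hr).bind fun Ψ _ hr' hts => ?_
    refine (forceable_term (v := fun i => (ts i).eval Ψ.S Fin.elim0) hw.1
      (D.rk_term_le _ (ht.1.trans hq)) (fun u => hdec _ (D.F_wf (e := .term _ _) hw.1 u)
        ((D.rkS_F_le φ _ u).trans_lt ht.1)) Ψ hr').imp fun Ξ hΞ hd => ?_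
    exact computes_skol.2 ⟨fun i => (hts i).mono hΞ.le,
      by simpa only [fun i => (hts i).eval_eq hΞ.le] using hd⟩

theorem forceable_decides_of_computes {q : ℕ}
    (hc : ∀ t : Term L 0, t.WF → t.rkS ≤ q → Forceable D Cr r fun Θ => Θ.S.Computes t)
    {φ : Formula L 0} (hw : φ.WF) (hφ : φ.rkS ≤ q) :
    Forceable D Cr r fun Θ => Θ.S.Decides φ := by
  induction φ with
  | top => exact .of_forall fun Θ => decides_top _
  | bot => exact .of_forall fun Θ => decides_bot _
  | eq s t =>
    simp only [Formula.WF, Formula.rkS, max_le_iff] at hw hφ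
    exact ((hc s hw.1 hφ.1).and (persistent_computes s) (hc t hw.2 hφ.2)).imp
      fun Θ => decides_eq.2
  | rel k R ts =>
    simp only [Formula.WF, Formula.rkS, Finset.sup_le_iff, Finset.mem_univ, true_imp_iff] at hw hφ
    exact (Forceable.forall_fin (fun i => hc _ (hw i) (hφ i))
      fun i => persistent_computes _).imp fun Θ => decides_rel.2
  | mem t =>
    simp only [Formula.WF, Formula.rkS] at hw hφ
    intro Θ hr
    refine (hc t hw hφ Θ hr).bind fun Ψ _ hr' ht => ?_
    refine (forceable_form (t.eval Ψ.S Fin.elim0) Ψ hr').imp fun Ξ hΞ hd => ?_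
    exact decides_mem.2 ⟨ht.mono hΞ.le, by rwa [ht.eval_eq hΞ.le]⟩
  | neg φ ihφ =>
    simp only [Formula.WF, Formula.rkS] at hw hφ
    exact (ihφ hw hφ).imp fun Θ => decides_neg.2
  | and φ ψ ihφ ihψ =>
    simp only [Formula.WF, Formula.rkS, max_le_iff] at hw hφ
    exact ((ihφ hw.1 hφ.1).and (persistent_decides _) (ihψ hw.2 hφ.2)).imp fun Θ => decides_and.2
  | or φ ψ ihφ ihψ =>
    simp only [Formula.WF, Formula.rkS, max_le_iff] at hw hφ
    exact ((ihφ hw.1 hφ.1).and (persistent_decides _) (ihψ hw.2 hφ.2)).imp fun Θ => decides_or.2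

theorem forceable_decides {φ : Formula L 0} (hw : φ.WF) (hr : φ.rkS ≤ r) :
    Forceable D Cr r fun Θ => Θ.S.Decides φ := by
  induction hq : φ.rkS using Nat.strong_induction_on generalizing φ with
  | _ q ih =>
    subst hq
    refine forceable_decides_of_computes (fun t ht htq => ?_) hw le_rfl
    exact forceable_computes_of_decides hr
      (fun ψ hψ hlt => ih _ hlt hψ (hlt.le.trans hr) rfl) ht htq

theorem forceable_canonical {k : ℕ} {φ : Formula L (k + 1)} (hφ : φ.IsMatrix) (v : Fin k → ℕ)
    (hr : φ.rkS < r) : Forceable D Cr r fun Θ => .term φ v ∈ Θ.S.dom :=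
  forceable_term hφ (D.rk_term_le v hr) fun u =>
    forceable_decides (D.F_wf (e := .term _ _) hφ u) ((D.rkS_F_le φ v u).trans hr.le)

theorem forceable_c (n : ℕ) : Forceable D Cr r fun Θ => D.c n ∈ Θ.S.dom :=
  forceable_term D.B_isMatrix.neg ((D.rk_c n).trans_le (Om_le_Om_add_add_one r)) fun u =>
    forceable_decides (D.F_wf (e := .term _ _) D.B_isMatrix.neg u) <|
      (D.rkS_F_le _ _ u).trans (by simp [Formula.rkS, D.noSkol.rkS_eq_zero])

end Forcing

/-! ### Correctness and active expressions -/

theorem Sub.IsSub.eq_unk_or_num {S : Sub L} (hS : S.IsSub) {k : ℕ} {φ : Formula L (k + 1)}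
    {v : Fin k → ℕ} (hd : .term φ v ∈ S.dom) :
    S (.term φ v) = some .unk ∨ ∃ u, S (.term φ v) = some (.num u) := by
  obtain ⟨_ | u | _, hu⟩ := Option.isSome_iff_exists.1 hd
  · exact .inl hu
  · exact .inr ⟨u, hu⟩
  · exact (hS _ _ hu).2.elim

theorem Sub.IsSub.form_eq_unk_or_tt {S : Sub L} (hS : S.IsSub) {n : ℕ} (hd : .form n ∈ S.dom) :
    S (.form n) = some .unk ∨ S (.form n) = some .tt := by
  obtain ⟨_ | u | _, hu⟩ := Option.isSome_iff_exists.1 hd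
  · exact .inl hu
  · exact (hS _ _ hu).2.elim
  · exact .inr hu

section Skolem

variable [L.Structure ℕ] {k n : ℕ} (S : Sub L) (x : Fin n → ℕ) (φ : Formula L (k + 1))
  (s : Fin k → Term L n) (t : Term L n)

theorem eval_cons : (fun i => (Fin.cons (α := fun _ => Term L n) t s i).eval S x) =
    Fin.cons (α := fun _ => ℕ) (t.eval S x) fun i => (s i).eval S x :=
  funext <| Fin.cases rfl fun _ => rfl

@[simp] theorem trueIn_inst : (inst φ s t).TrueIn S x ↔
    φ.TrueIn S (Fin.cons (t.eval S x) fun i => (s i).eval S x) := by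
  rw [inst, Formula.trueIn_subst, eval_cons]

@[simp] theorem trueIn_exF : (exF φ s).TrueIn S x ↔
    φ.TrueIn S (Fin.cons ((Term.skol φ s).eval S x) fun i => (s i).eval S x) :=
  trueIn_inst S x φ s _

@[simp] theorem trueIn_allF : (allF φ s).TrueIn S x ↔
    φ.TrueIn S (Fin.cons ((Term.skol φ.neg s).eval S x) fun i => (s i).eval S x) :=
  trueIn_inst S x φ s _

@[simp] theorem trueIn_instNum (v : Fin k → ℕ) (u : ℕ) :
    (instNum φ v u).TrueIn S Fin.elim0 ↔ φ.TrueIn S (Fin.cons u v) := by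
  simp [instNum]

theorem trueIn_prog (D : PosOp L) (a : ℕ) :
    (D.prog φ).TrueIn S (Fin.cons a fun i => (s i).eval S x) ↔
      ((D.Aφ φ s (numeral a)).TrueIn S x →
        φ.TrueIn S (Fin.cons a fun i => (s i).eval S x)) := by
  have eval_vars (y : Fin (k + 1) → ℕ) : (fun i => (Fin.cons (α := fun _ => Term L (k + 1))
      (.var 0) (fun i => .var i.succ) i).eval S y) = y :=
    funext <| Fin.cases rfl fun _ => rfl
  simp only [PosOp.prog, PosOp.Aφ, Formula.trueIn_imp, trueIn_allF, Term.eval, eval_vars, eval_cons,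
    eval_numeral]

variable {S x φ s} in
theorem eval_skol_eq {u : ℕ} (h : S (.term φ fun i => (s i).eval S x) = some (.num u)) :
    (Term.skol φ s).eval S x = u := by
  simp only [Term.eval, h]

end Skolem

section Correctness

variable [L.Structure ℕ] {D : PosOp L} {S : Sub L} {Θ : Sequent L}

theorem PosOp.Correct.trueIn {k u : ℕ} {φ : Formula L (k + 1)} {v : Fin k → ℕ}
    (hc : D.Correct S) (hS : S.IsSub) (h : S (.term φ v) = some (.num u)) :
    φ.TrueIn S (Fin.cons u v) := by
  have hF := hc _ _ h
  rw [(D.F_wf (hS _ _ h).1 _).sat_bar_iff] at hF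
  exact (trueIn_instNum S φ v u).1 hF.1

theorem PosOp.Correct.skol_eq_unk {k : ℕ} {φ : Formula L (k + 1)} {s : Fin k → Term L 0}
    (hc : D.Correct S) (hS : S.IsSub)
    (hd : .term φ (fun i => (s i).eval S Fin.elim0) ∈ S.dom)
    (h : ¬ (exF φ s).TrueIn S Fin.elim0) :
    S (.term φ fun i => (s i).eval S Fin.elim0) = some .unk := by
  refine (hS.eq_unk_or_num hd).resolve_right fun ⟨u, hu⟩ => h ?_
  rw [trueIn_exF, eval_skol_eq hu]
  exact hc.trueIn hS hu

theorem PosOp.Admissible.trueIn_B {P l l' : List ℕ} {n : ℕ} (h : D.Admissible P)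
    (hP : P = l ++ n :: l') : D.B.TrueIn (topSub l) (Fin.cons 0 fun _ => n) := by
  have hB := h l n l' hP
  rw [(D.noSkol.wf.subst (by simp [Fin.forall_fin_two])).sat_bar_iff, Formula.trueIn_subst] at hB
  convert hB using 1
  ext i
  fin_cases i <;> simp

/-- With `c_n` unset or `?`, `A(n, I)` is `B(0, n, I)`, which admissibility makes true already for
the part of `I` that precedes `n` in the history. -/
theorem Reachable.trueIn_A (h : Reachable D Θ) {n : ℕ} (hn : Θ.S (.form n) = some .tt)
    (hc : ∀ u, Θ.S (D.c n) = some u → u = .unk) : (D.A (numeral n)).TrueIn Θ.S Fin.elim0 := by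
  have skol_eq_zero : (Term.skol D.B.neg fun _ : Fin 1 => numeral n).eval Θ.S Fin.elim0 = 0 := by
    simp only [Term.eval, eval_numeral]
    split
    · next u hu => exact nomatch hc (.num u) hu
    · rfl
  have mem_P := h.isSequent.2.2.1
  obtain ⟨l, l', hl⟩ := List.append_of_mem ((mem_P n).2 hn)
  rw [PosOp.A, trueIn_allF, skol_eq_zero, eval_numeral]
  refine (Formula.TrueIn.mono_of_polar (fun m hm => (mem_P m).1 ?_) D.noSkol).1 D.pos
    (h.admissible.trueIn_B hl)
  have : m ∈ l := by by_contra hml; simp [topSub, hml] at hm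
  simp [hl, this]

theorem correct_of_not_CI (hr : Reachable D Θ) (he : SaturatedExt D Sequent.empty Θ)
    (hci : ¬ D.CI Θ.S) : D.Correct Θ.S := by
  intro e u h
  obtain ⟨hcan, hfits⟩ := hr.isSequent.1 e u h
  rw [(D.F_wf hcan u).sat_bar_iff]
  match e, u with
  | .term φ v, u =>
    by_contra hF
    refine hci (.inl ⟨_, _, h, sat_iff.2 ⟨decides_neg.2 (he.decides_F _ _ h rfl trivial), hF⟩⟩)
  | .form _, .unk => trivial
  | .form n, .tt =>
    exact hr.trueIn_A h fun u hu => by_contra fun hne => hci (.inr ⟨n, u, hu, hne, h⟩)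

end Correctness

section Active

variable (D : PosOp L) {S : Sub L} {P : List ℕ} {V : ℕ → Option (Sub L)} {e : CanExpr L} {v : Val}
  {n : ℕ}

theorem PosOp.mem_HS (h : e.IsTerm ∨ v = .tt) : (e, v) ∈ D.HS S P V e v := by
  unfold PosOp.HS
  split_ifs with _ he
  · exact .inr rfl
  · exact .inr rfl
  · exact .inr rfl
  · rw [h.resolve_left he]
    exact .inr rfl

theorem PosOp.active_self (he : S e = some .unk) (hv : v ≠ .unk) (h : e.IsTerm ∨ v = .tt) :
    D.Active S P V e v e :=
  ⟨by simp [Sub.dom, he], rfl, .inr ⟨v, D.mem_HS h, by simpa [he] using hv.symm⟩⟩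

theorem PosOp.negPart_form_ne_tt (T : Sub L) : D.negPart T (.form n) ≠ some .tt := by
  simp only [PosOp.negPart]
  intro h
  split at h
  · split_ifs at h with hT
    simp_all [PosOp.NegPair]
  · cases h

theorem notMem_before : n ∉ before P n := fun h => by
  simpa using List.mem_takeWhile_imp h

variable {D} in
theorem PosOp.IsHistory.form_notMem_HS_c (hV : D.IsHistory P V) (hn : n ∈ P) :
    (.form n, .tt) ∉ D.HS S P V (D.c n) v := by
  obtain ⟨T, hT⟩ := Option.isSome_iff_exists.1 ((hV.2.1 n).2 hn)
  have form_notMem_T : T (.form n) ≠ some .tt := (hV.2.2 n T hT).2.2 ▸ D.negPart_form_ne_tt T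
  have index_c : (D.c n).index = n := rfl
  have isTerm_c : (D.c n).IsTerm := trivial
  simp [PosOp.HS, index_c, isTerm_c, hn, hT, notMem_before, Sub.graph, form_notMem_T]

variable {D} in
/-- An `H`-step with `H`-expression `c_n` truncates the history before `n ∈ I`. -/
theorem PosOp.IsHistory.active_form (hV : D.IsHistory P V) (hn : n ∈ P)
    (hS : S (.form n) = some .tt) : D.Active S P V (D.c n) v (.form n) := by
  refine ⟨by simp [Sub.dom, hS], by simp, ?_⟩
  by_cases h : ∃ u, (.form n, u) ∈ D.HS S P V (D.c n) v
  · obtain ⟨u, hu⟩ := h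
    refine .inr ⟨u, hu, ?_⟩
    rw [hS]
    rintro ⟨⟩
    exact hV.form_notMem_HS_c hn hu
  · exact .inl (not_exists.1 h)

end Active

/-! ### Settled critical formulas -/

section Settled

variable [L.Structure ℕ] {D : PosOp L} {Θ Ψ : Sequent L} {k N r : ℕ} {Cr : Fin (N + 1) → Critical L}
  {φ : Formula L (k + 1)} {s : Fin k → Term L 0} {t : Term L 0}

/-- `c_{∃ x ¬(x ∈ I → φ(x, y⃗))}(s⃗)`, the element at which the conclusion of the closure formula of
`φ` and `s⃗` is evaluated. -/
def closureWitness (φ : Formula L (k + 1)) (s : Fin k → Term L 0) : Term L 0 :=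
  .skol ((Formula.mem (.var 0)).imp φ).neg s

/-- `S` contains the calculations by which the `H`-step repairs the closure formula of `φ` and `s⃗`
when it fails first at `n ∈ I`, where `v⃗` are the values of `s⃗`. -/
structure ClosureSettled (D : PosOp L) (S : Sub L) (φ : Formula L (k + 1)) (s : Fin k → Term L 0)
    (v : Fin k → ℕ) (n : ℕ) : Prop where
  decides_inst : S.Decides (inst φ s (numeral n))
  decides_A : S.Decides (D.Aφ φ s (numeral n))
  skol_mem_dom : .term (D.Bφ φ).neg (Fin.cons n v) ∈ S.dom
  c_mem_dom : D.c n ∈ S.dom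

/-- `Θ` decides `c` and contains the further calculations by which the `H`-step repairs `c` if it
fails. For a closure formula they only concern an initial segment of the history, which cannot grow
any more in extensions of `Θ`, but must contain the witness if that is in `I`. -/
def Settled (D : PosOp L) (Θ : Sequent L) (c : Critical L) : Prop :=
  Θ.S.Decides (c.toFormula D) ∧
    match c with
    | .pred _ => True
    | .eps _ _ _ => True
    | .ind φ s t => φ.Occ 0 → ∀ m ≤ t.eval Θ.S Fin.elim0, Θ.S.Decides (inst φ s (numeral m))
    | .inddef t => D.c (t.eval Θ.S Fin.elim0) ∈ Θ.S.dom
    | .closure φ s => ∃ P₀, P₀ <+: Θ.P ∧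
        (∀ m ∈ P₀, ClosureSettled D Θ.S φ s (fun i => (s i).eval Θ.S Fin.elim0) m) ∧
        ((Formula.mem (closureWitness φ s)).TrueIn Θ.S Fin.elim0 →
          (closureWitness φ s).eval Θ.S Fin.elim0 ∈ P₀)

theorem computes_closureWitness {S : Sub L}
    (h : S.Decides ((Critical.closure φ s).toFormula D)) :
    S.Computes (closureWitness φ s) ∧
      .form ((closureWitness φ s).eval S Fin.elim0) ∈ S.dom :=
  decides_mem.1 (decides_imp.1 (decides_imp.1 h).2).1

theorem persistent_closureSettled (s : Fin k → Term L 0) (v : Fin k → ℕ) (n : ℕ) :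
    Persistent D fun Θ => ClosureSettled D Θ.S φ s v n :=
  fun _ _ h ⟨hinst, hA, hskol, hc⟩ =>
    ⟨hinst.mono h.le, hA.mono h.le, h.le.mem_dom hskol, h.le.mem_dom hc⟩

theorem SaturatedExt.settled_closure (h : SaturatedExt D Θ Ψ) {P₀ : List ℕ} (hP₀ : P₀ <+: Θ.P)
    (hd : Θ.S.Decides ((Critical.closure φ s).toFormula D))
    (hset : ∀ m ∈ P₀, ClosureSettled D Ψ.S φ s (fun i => (s i).eval Θ.S Fin.elim0) m)
    (hwit : (Formula.mem (closureWitness φ s)).TrueIn Θ.S Fin.elim0 →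
      (closureWitness φ s).eval Θ.S Fin.elim0 ∈ P₀) : Settled D Ψ (.closure φ s) := by
  obtain ⟨hc, hdom⟩ := computes_closureWitness hd
  have eval_s : (fun i => (s i).eval Ψ.S Fin.elim0) = fun i => (s i).eval Θ.S Fin.elim0 :=
    funext fun i => ((computes_skol.1 hc).1 i).eval_eq h.le
  refine ⟨hd.mono h.le, P₀, hP₀.trans h.isPrefix, eval_s ▸ hset, fun htrue => ?_⟩
  have eval_witness := hc.eval_eq h.le
  simp only [Formula.TrueIn, eval_witness] at htrue ⊢
  exact hwit ((h.le.eq_of_mem_dom hdom).symm.trans htrue)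

theorem persistent_settled (c : Critical L) : Persistent D fun Θ => Settled D Θ c := by
  rintro Θ Ψ h ⟨hd, hc⟩
  refine ⟨hd.mono h.le, ?_⟩
  cases c with
  | pred s => trivial
  | eps φ s t => trivial
  | ind φ s t =>
    intro ho
    have ht : Θ.S.Computes t :=
      ho.computes_of_decides (decides_neg.1 (decides_and.1 (decides_imp.1 hd).1).2)
    simpa only [ht.eval_eq h.le] using fun m hm => (hc ho m hm).mono h.le
  | inddef t =>
    have ht : Θ.S.Computes t := (decides_mem.1 (decides_imp.1 hd).2).1
    simpa only [ht.eval_eq h.le] using h.le.mem_dom hc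
  | closure φ s =>
    obtain ⟨P₀, hP₀, hset, hwit⟩ := hc
    exact (h.settled_closure hP₀ hd
      (fun m hm => persistent_closureSettled s _ m Θ Ψ h (hset m hm)) hwit).2

theorem forces_settled_ind (hw : (Critical.ind φ s t).WF)
    (hr : ((Critical.ind φ s t).toFormula D).rkS ≤ r) (hΘ : Reachable D Θ)
    (hd : Θ.S.Decides ((Critical.ind φ s t).toFormula D)) :
    Forces D Cr r Θ fun Ψ => Settled D Ψ (.ind φ s t) := by
  by_cases ho : φ.Occ 0
  · have ht : Θ.S.Computes t :=
      ho.computes_of_decides (decides_neg.1 (decides_and.1 (decides_imp.1 hd).1).2)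
    have occ : (indStep φ).Occ 0 := .inl ho
    rw [Critical.toFormula, rkS_imp, max_le_iff] at hr
    obtain ⟨hstep, hs⟩ := occ.rkS_lt_of_inst_skol hr.2
    have hφ : φ.rkS ≤ r := (le_max_left _ _).trans hstep.le
    refine (Forceable.forall_mem (List.range (t.eval Θ.S Fin.elim0 + 1))
      (fun m _ => forceable_decides (hw.1.2.inst hw.2.1 (numeral_wf m))
        (rkS_inst_le hφ hs (by simp))) (fun m => persistent_decides _) Θ hΘ).imp
      fun Ψ hΨ h => ⟨hd.mono hΨ.le, fun _ m hm => h m ?_⟩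
    rw [ht.eval_eq hΨ.le] at hm
    exact List.mem_range.2 (Nat.lt_succ_of_le hm)
  · exact .of_holds hΘ ⟨hd, fun ho' => (ho ho').elim⟩

theorem forceable_closureSettled (hw : (Critical.closure φ s).WF) (hφ : φ.rkS < r)
    (hs : ∀ i, (s i).rkS ≤ r) (v : Fin k → ℕ) (n : ℕ) :
    Forceable D Cr r fun Θ => ClosureSettled D Θ.S φ s v n := by
  have decides_inst := forceable_decides (D := D) (Cr := Cr)
    (hw.1.2.inst hw.2 (numeral_wf n)) (rkS_inst_le hφ.le hs (by simp))
  have decides_A := forceable_decides (D := D) (Cr := Cr)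
    (D.Aφ_wf hw.1 hw.2 (numeral_wf n)) (D.rkS_Aφ_le hφ hs (by simp))
  have skol_mem_dom := forceable_canonical (D := D) (Cr := Cr) (D.Bφ_isMatrix hw.1).neg
    (Fin.cons n v) ((D.rkS_Bφ_le φ).trans_lt hφ)
  exact (decides_inst.and (persistent_decides _) (decides_A.and (persistent_decides _)
    (skol_mem_dom.and (persistent_mem_dom _) (forceable_c n)))).imp
      fun Θ ⟨hinst, hA, hskol, hc⟩ => ⟨hinst, hA, hskol, hc⟩

theorem forces_settled_closure (hw : (Critical.closure φ s).WF)
    (hr : ((Critical.closure φ s).toFormula D).rkS ≤ r) (hΘ : Reachable D Θ)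
    (hd : Θ.S.Decides ((Critical.closure φ s).toFormula D)) :
    Forces D Cr r Θ fun Ψ => Settled D Ψ (.closure φ s) := by
  have occ : ((Formula.mem (.var 0)).imp φ).Occ 0 := .inl rfl
  rw [Critical.toFormula, rkS_imp, max_le_iff] at hr
  obtain ⟨hrk, hs⟩ := occ.rkS_lt_of_inst_skol hr.2
  have hφ : φ.rkS < r :=
    (le_max_right _ _).trans_lt ((rkS_imp (.mem (.var 0)) φ).symm.trans_lt hrk)
  refine (Forceable.forall_mem Θ.P (fun m _ => forceable_closureSettled hw hφ hs
    (fun i => (s i).eval Θ.S Fin.elim0) m) (persistent_closureSettled s _) Θ hΘ).imp ?_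
  exact fun Ψ hΨ h => hΨ.settled_closure List.prefix_rfl hd h (hΘ.isSequent.2.2.1 _).2

theorem forceable_settled {c : Critical L} (hw : c.WF) (hr : (c.toFormula D).rkS ≤ r) :
    Forceable D Cr r fun Θ => Settled D Θ c := by
  intro Θ hΘ
  refine (forceable_decides (hw.toFormula D) hr Θ hΘ).bind fun Ψ _ hΨ hd => ?_
  cases c with
  | pred s => exact .of_holds hΨ ⟨hd, trivial⟩
  | eps φ s t => exact .of_holds hΨ ⟨hd, trivial⟩
  | ind φ s t => exact forces_settled_ind hw hr hΨ hd
  | inddef t =>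
    have ht : Ψ.S.Computes t := (decides_mem.1 (decides_imp.1 hd).2).1
    refine (forceable_c (t.eval Ψ.S Fin.elim0) Ψ hΨ).imp fun Ξ hΞ hc => ⟨hd.mono hΞ.le, ?_⟩
    simpa only [ht.eval_eq hΞ.le] using hc
  | closure φ s => exact forces_settled_closure hw hr hΨ hd

end Settled

/-! ### Repairing critical formulas -/

/-- The `H`-step can change `e` to `v`, and this affects a labelled expression. -/
structure ActiveRepair (D : PosOp L) (Θ : Sequent L) (e : CanExpr L) (v : Val) : Prop where
  eq_unk : Θ.S e = some .unk
  c_mem_dom : ∀ n, e = .form n → D.c n ∈ Θ.S.dom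
  exists_active : ∃ e', D.Active Θ.S Θ.P Θ.V e v e' ∧ D.Labelled Θ.S e'

theorem ActiveRepair.of_term {D : PosOp L} {Θ : Sequent L} {k : ℕ} {φ : Formula L (k + 1)}
    {v : Fin k → ℕ} {w : Val} (h : Θ.S (.term φ v) = some .unk) (hw : w ≠ .unk) :
    ActiveRepair D Θ (.term φ v) w where
  eq_unk := h
  c_mem_dom := nofun
  exists_active := ⟨_, D.active_self h hw (.inl trivial), .inl h⟩

section Repair

variable [L.Structure ℕ] {D : PosOp L} {Θ : Sequent L} {k : ℕ} {φ : Formula L (k + 1)}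
  {s : Fin k → Term L 0} {t : Term L 0}

/-- The repair of `c` is computed in `Θ` and affects a labelled expression. -/
def Repairable (D : PosOp L) (Θ : Sequent L) (c : Critical L) : Prop :=
  D.RepairComputed Θ.S Θ.P c ∧ ActiveRepair D Θ (D.repair Θ.S Θ.P c).1 (D.repair Θ.S Θ.P c).2

theorem Formula.Occ.of_decides_inst_skol {S : Sub L} {ψ : Formula L (k + 1)} (hφ : φ.Occ 0)
    (h : S.Decides (inst φ s (.skol ψ s))) :
    (∀ i, S.Computes (s i)) ∧ .term ψ (fun i => (s i).eval S Fin.elim0) ∈ S.dom :=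
  computes_skol.1 (hφ.computes_of_decides h)

theorem PosOp.Correct.activeRepair (hc : D.Correct Θ.S) (hS : Θ.S.IsSub) (hφ : φ.Occ 0)
    (hd : Θ.S.Decides (exF φ s)) (h : ¬ (exF φ s).TrueIn Θ.S Fin.elim0) (u : ℕ) :
    ActiveRepair D Θ (.term φ fun i => (s i).eval Θ.S Fin.elim0) (.num u) :=
  .of_term (hc.skol_eq_unk hS (hφ.of_decides_inst_skol hd).2 h) nofun

theorem repairable_pred (hc : D.Correct Θ.S) (hS : Θ.S.IsSub) (hw : t.WF)
    (hd : Θ.S.Decides ((Critical.pred t).toFormula D))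
    (hf : ¬ ((Critical.pred t).toFormula D).TrueIn Θ.S Fin.elim0) :
    Repairable D Θ (.pred t) := by
  rw [Critical.toFormula, Formula.trueIn_imp, Classical.not_imp] at hf
  have occ : (predMatrix : Formula L 2).Occ 0 := .inr rfl
  have hex := (decides_imp.1 hd).2
  refine ⟨(occ.of_decides_inst_skol hex).1 0, ?_⟩
  simpa only [PosOp.repair, hw.ev_eq] using hc.activeRepair hS occ hex hf.2 _

theorem repairable_eps (hc : D.Correct Θ.S) (hS : Θ.S.IsSub) (hw : (Critical.eps φ s t).WF)
    (hd : Θ.S.Decides ((Critical.eps φ s t).toFormula D))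
    (hf : ¬ ((Critical.eps φ s t).toFormula D).TrueIn Θ.S Fin.elim0) :
    Repairable D Θ (.eps φ s t) := by
  obtain ⟨hinst, hex⟩ := decides_imp.1 hd
  rw [Critical.toFormula, Formula.trueIn_imp, Classical.not_imp, trueIn_inst] at hf
  have occ : φ.Occ 0 := by
    by_contra ho
    exact hf.2 ((trueIn_exF _ _ _ _).2 ((Formula.trueIn_cons_congr ho _ _ _).1 hf.1))
  refine ⟨⟨(occ.of_decides_inst_skol hex).1, occ.computes_of_decides hinst⟩, ?_⟩
  simpa only [PosOp.repair, fun i => (hw.2.1 i).ev_eq (S := Θ.S)] using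
    hc.activeRepair hS occ hex hf.2 _

theorem repairable_ind (hc : D.Correct Θ.S) (hS : Θ.S.IsSub) (hw : (Critical.ind φ s t).WF)
    (hd : Settled D Θ (.ind φ s t))
    (hf : ¬ ((Critical.ind φ s t).toFormula D).TrueIn Θ.S Fin.elim0) :
    Repairable D Θ (.ind φ s t) := by
  obtain ⟨hdec, hset⟩ := hd
  obtain ⟨hprem, hex⟩ := decides_imp.1 hdec
  rw [Critical.toFormula, Formula.trueIn_imp, Classical.not_imp] at hf
  obtain ⟨⟨h0, ht⟩, hf⟩ := hf
  have occ : φ.Occ 0 := by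
    by_contra ho
    rw [trueIn_inst] at h0
    exact ht ((trueIn_inst _ _ _ _ _).2 ((Formula.trueIn_cons_congr ho _ _ _).1 h0))
  have occ' : (indStep φ).Occ 0 := .inl occ
  refine ⟨⟨(occ'.of_decides_inst_skol hex).1,
    occ.computes_of_decides (decides_neg.1 (decides_and.1 hprem).2), fun m hm => ?_⟩, ?_⟩
  · exact hset occ m (hw.2.2.ev_eq ▸ hm)
  · simpa only [PosOp.repair, fun i => (hw.2.1 i).ev_eq (S := Θ.S)] using
      hc.activeRepair hS occ' hex hf _

theorem repairable_inddef (hS : Θ.S.IsSub) (hw : t.WF) (hd : Settled D Θ (.inddef t))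
    (hf : ¬ ((Critical.inddef t).toFormula D).TrueIn Θ.S Fin.elim0) :
    Repairable D Θ (.inddef t) := by
  obtain ⟨hdec, hset⟩ := hd
  obtain ⟨ht, hdom⟩ := decides_mem.1 (decides_imp.1 hdec).2
  rw [Critical.toFormula, Formula.trueIn_imp, Classical.not_imp] at hf
  have unk := (hS.form_eq_unk_or_tt hdom).resolve_right hf.2
  refine ⟨ht, ?_⟩
  simp only [PosOp.repair, hw.ev_eq]
  exact ⟨unk, fun n hn => by cases hn; exact hset, _, D.active_self unk nofun (.inr rfl), .inl unk⟩

theorem exists_firstFail {S : Sub L} {P P₀ : List ℕ} (hP : P₀ <+: P) {d : ℕ} (hd : d ∈ P₀)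
    (hφ : S.bar.Sat (inst φ s (numeral d)).neg) :
    ∃ l n l', P = l ++ n :: l' ∧ firstFail S P φ s = some n ∧
      S.bar.Sat (inst φ s (numeral n)).neg ∧ ∀ m ∈ l ++ [n], m ∈ P₀ := by
  obtain ⟨n, hn⟩ : ∃ n, firstFail S P₀ φ s = some n :=
    Option.isSome_iff_exists.1 (List.find?_isSome.2 ⟨d, hd, by simpa using hφ⟩)
  obtain ⟨hfail, l, l', rfl, -⟩ := List.find?_eq_some_iff_append.1 hn
  obtain ⟨P₁, rfl⟩ := hP
  exact ⟨l, n, l' ++ P₁, by simp, (List.prefix_append _ _).find?_eq_some hn, by simpa using hfail,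
    fun m hm => by grind⟩

theorem activeRepair_c (hr : Reachable D Θ) (hci : ¬ D.CI Θ.S) {n : ℕ} (hn : n ∈ Θ.P)
    (hd : D.c n ∈ Θ.S.dom) (v : Val) : ActiveRepair D Θ (D.c n) v := by
  have hI : Θ.S (.form n) = some .tt := (hr.isSequent.2.2.1 n).1 hn
  refine ⟨?_, nofun, .form n, hr.isSequent.2.1.active_form hn hI,
    .inr ⟨by simp [Sub.dom, hI], D.rk_form n⟩⟩
  obtain ⟨u, hu⟩ := Option.isSome_iff_exists.1 hd
  obtain rfl : u = .unk := by_contra fun hne => hci (.inr ⟨n, u, hu, hne, hI⟩)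
  exact hu

theorem activeRepair_prog (hc : D.Correct Θ.S) (hS : Θ.S.IsSub)
    (hd : Θ.S.Decides (allF (D.prog φ) s))
    (hprog : (allF (D.prog φ) s).TrueIn Θ.S Fin.elim0) {n : ℕ}
    (hA : (D.Aφ φ s (numeral n)).TrueIn Θ.S Fin.elim0)
    (hn : ¬ (inst φ s (numeral n)).TrueIn Θ.S Fin.elim0) (u : ℕ) :
    ActiveRepair D Θ (.term (D.prog φ).neg fun i => (s i).eval Θ.S Fin.elim0) (.num u) := by
  have not_prog : ¬ (D.prog φ).TrueIn Θ.S (Fin.cons n fun i => (s i).eval Θ.S Fin.elim0) := by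
    rw [trueIn_prog]
    exact fun h => hn (by simpa using h hA)
  have occ : (D.prog φ).Occ 0 := by
    by_contra ho
    exact not_prog ((Formula.trueIn_cons_congr ho _ _ _).1 ((trueIn_allF _ _ _ _).1 hprog))
  exact hc.activeRepair hS (φ := (D.prog φ).neg) occ (decides_neg.2 hd) (not_not.2 hprog) u

theorem repairable_closure (hr : Reachable D Θ) (hci : ¬ D.CI Θ.S) (hc : D.Correct Θ.S)
    (hw : (Critical.closure φ s).WF) (hd : Settled D Θ (.closure φ s))
    (hf : ¬ ((Critical.closure φ s).toFormula D).TrueIn Θ.S Fin.elim0) :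
    Repairable D Θ (.closure φ s) := by
  obtain ⟨hdec, P₀, hP₀, hset, hwit⟩ := hd
  rw [Critical.toFormula, Formula.trueIn_imp, Classical.not_imp] at hf
  obtain ⟨hprog, hconcl⟩ := hf
  rw [trueIn_allF, Formula.trueIn_imp, Classical.not_imp] at hconcl
  obtain ⟨hmem, hφ⟩ := hconcl
  have sat_neg_inst (m : ℕ) : Θ.S.bar.Sat (inst φ s (numeral m)).neg ↔
      ¬ (inst φ s (numeral m)).TrueIn Θ.S Fin.elim0 :=
    (hw.1.2.inst hw.2 (numeral_wf m)).neg.sat_bar_iff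
  have ev_s : (fun i => Θ.S.ev (s i)) = fun i => (s i).eval Θ.S Fin.elim0 :=
    funext fun i => (hw.2 i).ev_eq
  obtain ⟨l, n, l', hP, hfirst, hfail, hl⟩ := exists_firstFail hP₀ (hwit hmem)
    ((sat_neg_inst _).2 (by rwa [trueIn_inst, eval_numeral]))
  obtain ⟨-, decides_A, skol_mem_dom, c_mem_dom⟩ := hset n (hl n (by simp))
  refine ⟨⟨(computes_skol.1 (computes_closureWitness hdec).1).1, l, n, l', hP, hfirst,
    fun m hm => (hset m (hl m hm)).decides_inst, decides_A, fun _ => ev_s ▸ skol_mem_dom⟩, ?_⟩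
  simp only [PosOp.repair, hfirst, Option.getD_some]
  split_ifs with hA
  · exact activeRepair_c hr hci (by simp [hP]) c_mem_dom _
  · rw [hfirst, Option.getD_some, (D.Aφ_wf hw.1 hw.2 (numeral_wf n)).neg.sat_bar_iff] at hA
    rw [ev_s]
    exact activeRepair_prog hc hr.isSequent.1 (decides_imp.1 hdec).1 hprog (not_not.1 hA)
      ((sat_neg_inst n).1 hfail) n

theorem Settled.repairable {c : Critical L} (h : Settled D Θ c) (hr : Reachable D Θ)
    (hci : ¬ D.CI Θ.S) (hc : D.Correct Θ.S) (hw : c.WF)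
    (hf : ¬ Θ.S.bar.Sat (c.toFormula D)) : Repairable D Θ c := by
  rw [(hw.toFormula D).sat_bar_iff] at hf
  have hS := hr.isSequent.1
  cases c with
  | pred t => exact repairable_pred hc hS hw h.1 hf
  | eps φ s t => exact repairable_eps hc hS hw h.1 hf
  | ind φ s t => exact repairable_ind hc hS hw h hf
  | inddef t => exact repairable_inddef hS hw h hf
  | closure φ s => exact repairable_closure hr hci hc hw h hf

end Repair

section Axioms

variable [L.Structure ℕ] {D : PosOp L} {Θ : Sequent L} {N : ℕ} {Cr : Fin (N + 1) → Critical L}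

theorem exists_isHIndex {S : Sub L} (P : List ℕ) (h : ¬ D.Solving Cr S) :
    ∃ i, D.IsHIndex Cr S P i := by
  classical
  obtain ⟨i, hi, hmin⟩ := Finset.exists_min_image {i | ¬ S.bar.Sat ((Cr i).toFormula D)}
    (fun i => toLex (D.rk (D.repair S P (Cr i)).1, i))
    (by simpa [Finset.filter_nonempty_iff, PosOp.Solving] using h)
  simp only [Finset.mem_filter, Finset.mem_univ, true_and, Prod.Lex.toLex_le_toLex] at hi hmin
  refine ⟨i, hi, fun j hj => ?_⟩
  rcases hmin j hj with hlt | ⟨heq, hle⟩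
  · exact ⟨hlt.le, fun h' => (hlt.ne' h').elim⟩
  · exact ⟨heq.le, fun _ => hle⟩

theorem isAxiom_of_settled (hCr : ∀ i, (Cr i).WF) (hr : Reachable D Θ)
    (he : SaturatedExt D Sequent.empty Θ) (h : ∀ i, Settled D Θ (Cr i)) : D.IsAxiom Cr Θ := by
  by_cases hci : D.CI Θ.S
  · exact .inl hci
  by_cases hsol : D.Solving Cr Θ.S
  · exact .inr (.inl hsol)
  have hc := correct_of_not_CI hr he hci
  have repairable (i : Fin (N + 1)) := (h i).repairable hr hci hc (hCr i)
  obtain ⟨i, hi⟩ := exists_isHIndex Θ.P hsol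
  obtain ⟨-, eq_unk, c_mem_dom, e', active, labelled⟩ := repairable i hi.1
  have form_mem_dom (n : ℕ) (hn : D.c n ∈ Θ.S.dom) : .form n ∈ Θ.S.dom :=
    he.form_mem_dom n hn (by simp [Sequent.empty, Sub.dom])
  have label_false : Θ.F e' = some false := by
    obtain ⟨b, hb⟩ := Option.isSome_iff_exists.1 ((hr.isSequent.2.2.2 e').2 labelled)
    rwa [hr.label_eq_false e' b hb] at hb
  refine .inr (.inr ⟨_, _, ⟨hc, hsol, fun j => (h j).1, fun j hj => (repairable j hj).1,
    ⟨i, hi, rfl⟩, eq_unk, fun n hn => form_mem_dom n ?_, c_mem_dom,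
    fun _ _ m hm => form_mem_dom m (by simp [Sub.dom, hm])⟩, e', active, label_false⟩)
  exact hn ▸ Option.isSome_iff_exists.2 ⟨_, eq_unk⟩

end Axioms

theorem reachable_empty [L.Structure ℕ] (D : PosOp L) : Reachable D Sequent.empty := by
  refine ⟨⟨?_, ⟨?_, ?_, ?_⟩, ?_, ?_⟩, ?_, ?_⟩ <;>
    simp [Sequent.empty, Sub.IsSub, PosOp.Labelled, Sub.dom, PosOp.Admissible]

theorem le_rho_empty [L.Structure ℕ] (D : PosOp L) {N : ℕ} (Cr : Fin (N + 1) → Critical L)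
    (i : Fin (N + 1)) :
    ((Cr i).toFormula D).rkS ≤ D.rho Sequent.empty (Set.range fun i => (Cr i).toFormula D) := by
  refine (Formula.rkS_le_red_empty _).trans (le_csSup ?_ ⟨_, .inl ⟨i, rfl⟩, rfl⟩)
  refine (Set.finite_range fun i => (((Cr i).toFormula D).red fun _ => none).rkS).bddAbove.mono ?_
  rintro m ⟨φ, ⟨i, rfl⟩ | ⟨e, u, he, -⟩, rfl⟩
  · exact ⟨i, rfl⟩
  · cases he

end EpsID1

end

theorem mainTheorem6 (L : FirstOrder.Language.{0, 0}) [L.Structure ℕ] (D : EpsID1.PosOp L)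
    (N : ℕ) (Cr : Fin (N + 1) → EpsID1.Critical L) (hCr : ∀ i, (Cr i).WF) :
    ∃ d : EpsID1.Derivation D Cr EpsID1.Sequent.empty,
      d.AllRules (D.IsCutLE
        (EpsID1.Om + ((D.rho EpsID1.Sequent.empty
          (Set.range fun i => (Cr i).toFormula D) : ℕ) : Ordinal.{0}) + 1)) := by
  have forceable_settled :=
    EpsID1.Forceable.forall_fin
      (fun i => EpsID1.forceable_settled (Cr := Cr) (hCr i) (EpsID1.le_rho_empty D Cr i))
      fun i => EpsID1.persistent_settled (Cr i)
  refine forceable_settled _ (EpsID1.reachable_empty D) fun Θ hΘ hr settled => ?_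
  exact ⟨.ax Θ hr.isSequent (EpsID1.isAxiom_of_settled hCr hr hΘ settled), trivial⟩
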